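/- Let $d\ge 1$ and let $\Omega\subset\mathbb{R}^d$ be a bounded domain (a bounded non-empty open set; connectedness is not needed). Let $H^1_0(\Omega)$ be the closure of $C_c^\infty(\Omega)$ in the $H^1$ norm. The eigenvalues of the Dirichlet Laplacian on $\Omega$ are the numbers $\mu$ for which there is $u\in H^1_0(\Omega)$, $u\neq 0$, with $\int_\Omega\nabla u\cdot\nabla v=\mu\int_\Omega uv$ for all $v\in H^1_0(\Omega)$. They can be listed, with multiplicity, as a sequence $0<\lambda_1\le\lambda_2\le\cdots$ with $\lambda_k\to\infty$. For real $\sigma$ and $z$ define the Riesz mean $$R_\sigma(z)=\sum_{k:\ \lambda_k<z}(z-\lambda_k)^\sigma ,$$ which is $\sum_k (z-\lambda_k)_+^\sigma$ if $\sigma>0$, and $\#\{k:\lambda_k<z\}=\lim_{\sigma\downarrow 0}R_\sigma(z)$ if $\sigma=0$. 1. Let $0<\sigma\le 2$. For all $z\ge\lambda_1$, $$R_{\sigma-1}(z)\ \ge\ \Bigl(1+\frac d4\Bigr)\frac1z\,R_\sigma(z),\qquad R_\sigma'(z)\ \ge\ \Bigl(1+\frac d4\Bigr)\frac{\sigma}{z}\,R_\sigma(z),$$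 and $z\mapsto R_\sigma(z)/z^{\sigma+d\sigma/4}$ is nondecreasing on $[\lambda_1,\infty)$. Here $R_\sigma$ is differentiable at $z$ if $\sigma>1$ or if $z$ is not an eigenvalue; in the remaining case ($\sigma\le 1$ and $z$ an eigenvalue) the inequality for $R_\sigma'$ means that $\liminf_{w\to z}\frac{R_\sigma(w)-R_\sigma(z)}{w-z}\ge\bigl(1+\frac d4\bigr)\frac{\sigma}{z}R_\sigma(z)$. 2. Let $\sigma\ge 2$. For all $z\ge\lambda_1$, $R_\sigma$ is differentiable at $z$, $$R_{\sigma-1}(z)\ \ge\ \Bigl(1+\frac d{2\sigma}\Bigr)\frac1z\,R_\sigma(z),\qquad R_\sigma'(z)\ \ge\ \Bigl(\sigma+\frac d2\Bigr)\frac1z\,R_\sigma(z),$$ and $z\mapsto R_\sigma(z)/z^{\sigma+d/2}$ is nondecreasing on $[\lambda_1,\infty)$. -/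

import Mathlib

open MeasureTheory Filter Topology TopologicalSpace
open scoped Distributions

noncomputable section

/-- `L²(Ω)`, real valued. -/
abbrev L2 {d : ℕ} (Ω : Opens (EuclideanSpace ℝ (Fin d))) : Type :=
  Lp ℝ 2 (volume.restrict (Ω : Set (EuclideanSpace ℝ (Fin d))))

/-- `L²(Ω; ℝᵈ)`, square integrable vector fields. -/
abbrev L2Vec {d : ℕ} (Ω : Opens (EuclideanSpace ℝ (Fin d))) : Type :=
  Lp (EuclideanSpace ℝ (Fin d)) 2 (volume.restrict (Ω : Set (EuclideanSpace ℝ (Fin d))))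

/-- The Hilbert space `L²(Ω) × L²(Ω; ℝᵈ)`; via `u ↦ (u, ∇u)` the norm of `H¹(Ω)` is the norm of
this space. -/
abbrev L2Pair {d : ℕ} (Ω : Opens (EuclideanSpace ℝ (Fin d))) : Type :=
  WithLp 2 (L2 Ω × L2Vec Ω)

/-- The pairs `(φ, ∇φ)` with `φ ∈ C_c^∞(Ω)`. -/
def testGraph {d : ℕ} (Ω : Opens (EuclideanSpace ℝ (Fin d))) : Submodule ℝ (L2Pair Ω) where
  carrier := {p | ∃ φ : 𝓓(Ω, ℝ),
    (p.fst =ᵐ[volume.restrict (Ω : Set (EuclideanSpace ℝ (Fin d)))] fun x => φ x) ∧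
    (p.snd =ᵐ[volume.restrict (Ω : Set (EuclideanSpace ℝ (Fin d)))] fun x => gradient φ x)}
  zero_mem' := by
    refine ⟨0, ?_, ?_⟩
    · filter_upwards [Lp.coeFn_zero ℝ 2
        (volume.restrict (Ω : Set (EuclideanSpace ℝ (Fin d))))] with x hx
      simpa using hx
    · filter_upwards [Lp.coeFn_zero (EuclideanSpace ℝ (Fin d)) 2
        (volume.restrict (Ω : Set (EuclideanSpace ℝ (Fin d))))] with x hx
      simpa [gradient] using hx
  add_mem' := by
    rintro p q ⟨φ, h1, h2⟩ ⟨ψ, h3, h4⟩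
    refine ⟨φ + ψ, ?_, ?_⟩
    · filter_upwards [Lp.coeFn_add p.fst q.fst, h1, h3] with x hx h1 h3
      refine hx.trans ?_
      simp [h1, h3]
    · filter_upwards [Lp.coeFn_add p.snd q.snd, h2, h4] with x hx h2 h4
      have e1 : DifferentiableAt ℝ φ x := (φ.contDiff.differentiable (by simp)) x
      have e2 : DifferentiableAt ℝ ψ x := (ψ.contDiff.differentiable (by simp)) x
      refine hx.trans ?_
      simp [h2, h4, gradient, fderiv_add e1 e2]
  smul_mem' := by
    rintro c p ⟨φ, h1, h2⟩
    refine ⟨c • φ, ?_, ?_⟩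
    · filter_upwards [Lp.coeFn_smul c p.fst, h1] with x hx h1
      simp [hx, h1]
    · filter_upwards [Lp.coeFn_smul c p.snd, h2] with x hx h2
      have e1 : DifferentiableAt ℝ φ x := (φ.contDiff.differentiable (by simp)) x
      simp [hx, h2, gradient, fderiv_const_smul e1]

/-- The Sobolev space `H¹₀(Ω)`, the closure of `C_c^∞(Ω)` in the `H¹` norm. A function `u` is
represented by the pair `(u, ∇u)`; the second component of a limit of pairs `(φₙ, ∇φₙ)` is the
weak gradient of the first, and so is determined by it. -/
def H10 {d : ℕ} (Ω : Opens (EuclideanSpace ℝ (Fin d))) : Submodule ℝ (L2Pair Ω) :=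
  (testGraph Ω).topologicalClosure

/-- The eigenspace of the Dirichlet Laplacian `-Δ` on `Ω` for the value `μ`: all `u ∈ H¹₀(Ω)` with
`-Δu = μ u` weakly, that is `∫_Ω ∇u · ∇v = μ ∫_Ω u v` for every `v ∈ H¹₀(Ω)`. -/
def dirichletEigenspace {d : ℕ} (Ω : Opens (EuclideanSpace ℝ (Fin d))) (μ : ℝ) :
    Submodule ℝ (H10 Ω) where
  carrier := {u | ∀ v : H10 Ω,
    inner ℝ (u : L2Pair Ω).snd (v : L2Pair Ω).snd =
      μ * inner ℝ (u : L2Pair Ω).fst (v : L2Pair Ω).fst}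
  zero_mem' := by
    intro v
    simp
  add_mem' := by
    intro u w hu hw v
    have h1 := hu v
    have h2 := hw v
    simp only [Submodule.coe_add, WithLp.add_fst, WithLp.add_snd, inner_add_left, h1, h2]
    ring
  smul_mem' := by
    intro c u hu v
    have h1 := hu v
    simp only [Submodule.coe_smul, WithLp.smul_fst, WithLp.smul_snd, real_inner_smul_left, h1]
    ring

/-- `lam 0 ≤ lam 1 ≤ …` is the list of all the eigenvalues of the Dirichlet Laplacian on `Ω`, in
nondecreasing order, each one repeated according to its multiplicity: every real `μ` occurs in the
list exactly `dim (eigenspace of μ)` times. The entry `lam k` is the eigenvalue with index `k + 1`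
in the usual numbering, which starts at `1`. -/
structure IsDirichletSpectrum {d : ℕ} (Ω : Opens (EuclideanSpace ℝ (Fin d)))
    (lam : ℕ → ℝ) : Prop where
  monotone : Monotone lam
  multiplicity : ∀ μ : ℝ,
    Cardinal.mk {k : ℕ // lam k = μ} = Module.rank ℝ (dirichletEigenspace Ω μ)

/-- The Riesz mean `R_σ(z) = ∑ₖ (z - λₖ)₊^σ`, where only the terms with `λₖ < z` contribute. For
`σ > 0` this is the power of the positive part; for `σ = 0` it counts the `λₖ < z`, the limit of
`R_σ(z)` as `σ ↓ 0`; for `σ < 0` it keeps the terms that are defined. -/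
def rieszMean (lam : ℕ → ℝ) (σ z : ℝ) : ℝ :=
  ∑' k, if lam k < z then (z - lam k) ^ σ else 0

end

/-!
Let `u₁, …, u_N` be `L²`-orthonormal eigenfunctions exhausting the eigenvalues below `z`. For each
coordinate `xₐ`, the component of `xₐ uᵢ` orthogonal to all the `uⱼ` is an admissible trial function
for the first omitted eigenvalue. As `[-Δ, xₐ] = -2 ∂ₐ`, its energy excess is read off from
`∂ₐ uᵢ`, and the cross terms cancel by antisymmetry after weighting with `(z - λᵢ)`. Summation over
`a` gives Yang's inequality `d ∑ᵢ (z - λᵢ)² ≤ 4 ∑ᵢ (z - λᵢ) λᵢ`, which is the case `σ = 2`.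
The exponents `σ ≤ 2` follow by comparing `(z - λ)^(σ - 2)` with its value at the `λ` where the
summand changes sign, the exponents `σ ≥ 2` by integrating over `z` (Riesz iteration). The
inequality bounds the logarithmic derivative of `R_σ` from below, whence the monotonicity.
The same inequality, applied to the full list of eigenfunctions with `z` large, shows that a list
of eigenvalues cannot be finite.
-/

noncomputable section

open scoped ENNReal

/-! ### Yang's inequality for symmetric forms -/

section AbstractYang

variable {E ι : Type*} [NormedAddCommGroup E] [InnerProductSpace ℝ E] [Fintype ι]

/-- The residual `x - ∑ⱼ ⟪x, Uⱼ⟫ Uⱼ`: the component of `x` orthogonal to the orthonormal family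
`U`. -/
def orthonormalResidual (U : ι → E) (x : E) : E :=
  x - ∑ j, inner ℝ x (U j) • U j

theorem inner_orthonormalResidual (U : ι → E) (x y : E) :
    inner ℝ y (orthonormalResidual U x) =
      inner ℝ y x - ∑ j, inner ℝ x (U j) * inner ℝ y (U j) := by
  simp only [orthonormalResidual, inner_sub_right, inner_sum, real_inner_smul_right]

theorem inner_apply_orthonormalResidual {U : ι → E} (hU : Orthonormal ℝ U) (j : ι) (x : E) :
    inner ℝ (U j) (orthonormalResidual U x) = 0 := by
  rw [orthonormalResidual, inner_sub_right, hU.inner_right_fintype, real_inner_comm, sub_self]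

theorem inner_orthonormalResidual_left {U : ι → E} (hU : Orthonormal ℝ U) (x y : E) :
    inner ℝ (orthonormalResidual U y) (orthonormalResidual U x) =
      inner ℝ y (orthonormalResidual U x) := by
  rw [orthonormalResidual.eq_def U y, inner_sub_left, sum_inner]
  simp only [real_inner_smul_left, inner_apply_orthonormalResidual hU, mul_zero,
    Finset.sum_const_zero, sub_zero]

theorem norm_orthonormalResidual_sq {U : ι → E} (hU : Orthonormal ℝ U) (x : E) :
    ‖orthonormalResidual U x‖ ^ 2 = ‖x‖ ^ 2 - ∑ j, inner ℝ x (U j) ^ 2 := by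
  rw [← real_inner_self_eq_norm_sq, inner_orthonormalResidual_left hU, inner_orthonormalResidual,
    real_inner_self_eq_norm_sq]
  simp only [sq]

theorem mul_neg_two_inner_le {a : ℝ} (ha : 0 ≤ a) {p φ : E}
    (h : a * ‖φ‖ ^ 2 ≤ -2 * inner ℝ p φ) : a * (-2 * inner ℝ p φ) ≤ 4 * ‖p‖ ^ 2 := by
  have expand : ‖a • φ + (2 : ℝ) • p‖ ^ 2 =
      a * (a * ‖φ‖ ^ 2) + 4 * a * inner ℝ p φ + 4 * ‖p‖ ^ 2 := by
    rw [norm_add_sq_real, norm_smul, norm_smul, real_inner_smul_left, real_inner_smul_right,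
      real_inner_comm, mul_pow, mul_pow, Real.norm_eq_abs, sq_abs]
    norm_num
    ring
  linarith [sq_nonneg ‖a • φ + (2 : ℝ) • p‖, mul_le_mul_of_nonneg_left h ha]

theorem mul_one_add_sum_le_of_commutator {U : ι → E} (hU : Orthonormal ℝ U) {a : ℝ} (ha : 0 ≤ a)
    {x p : E} {c : ι → ℝ} (hcomm : ∀ j, 2 * inner ℝ p (U j) = c j * inner ℝ x (U j))
    (hpx : -2 * inner ℝ p x = 1)
    (hgap : a * ‖orthonormalResidual U x‖ ^ 2 ≤ -2 * inner ℝ p (orthonormalResidual U x)) :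
    a * (1 + ∑ j, c j * inner ℝ x (U j) ^ 2) ≤
      4 * ‖p‖ ^ 2 - ∑ j, c j ^ 2 * inner ℝ x (U j) ^ 2 := by
  have hinner : -2 * inner ℝ p (orthonormalResidual U x) =
      1 + ∑ j, c j * inner ℝ x (U j) ^ 2 := by
    rw [inner_orthonormalResidual, mul_sub, hpx, sub_eq_add_neg, Finset.mul_sum,
      ← Finset.sum_neg_distrib]
    congr 1
    refine Finset.sum_congr rfl fun j _ => ?_
    linear_combination inner ℝ x (U j) * hcomm j
  have hnorm : 4 * ‖orthonormalResidual U p‖ ^ 2 =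
      4 * ‖p‖ ^ 2 - ∑ j, c j ^ 2 * inner ℝ x (U j) ^ 2 := by
    rw [norm_orthonormalResidual_sq hU, mul_sub, Finset.mul_sum]
    congr 1
    refine Finset.sum_congr rfl fun j _ => ?_
    rw [← mul_pow, ← hcomm j]
    ring
  rw [← hinner, ← hnorm]
  rw [← inner_orthonormalResidual_left hU] at hgap ⊢
  exact mul_neg_two_inner_le ha hgap

theorem sum_sum_eq_zero_of_antisymm {F : ι → ι → ℝ} (hF : ∀ i j, F j i = -F i j) :
    ∑ i, ∑ j, F i j = 0 := by
  refine self_eq_neg.1 ?_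
  calc ∑ i, ∑ j, F i j = ∑ j, ∑ i, F i j := Finset.sum_comm
    _ = ∑ j, ∑ i, -F j i := by simp only [← hF]
    _ = -∑ j, ∑ i, F j i := by simp only [Finset.sum_neg_distrib]

/-- In the application `U` consists of eigenfunctions, `X i = xₐ Uᵢ` and `D i = ∂ₐ Uᵢ`: `hcomm` is
the commutator identity `[-Δ, xₐ] = -2 ∂ₐ`, and `hgap` says that all eigenvalues below `z` are
listed. -/
theorem sum_sq_le_of_commutator {U X D : ι → E} {lam : ι → ℝ} {z : ℝ} (hU : Orthonormal ℝ U)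
    (hlam : ∀ i, lam i ≤ z) (hX : ∀ i j, inner ℝ (X i) (U j) = inner ℝ (X j) (U i))
    (hcomm : ∀ i j, 2 * inner ℝ (D i) (U j) = (lam i - lam j) * inner ℝ (X i) (U j))
    (hDX : ∀ i, -2 * inner ℝ (D i) (X i) = 1)
    (hgap : ∀ i, (z - lam i) * ‖orthonormalResidual U (X i)‖ ^ 2 ≤
      -2 * inner ℝ (D i) (orthonormalResidual U (X i))) :
    ∑ i, (z - lam i) ^ 2 ≤ 4 * ∑ i, (z - lam i) * ‖D i‖ ^ 2 := by
  have weighted : ∀ i, (z - lam i) ^ 2 +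
      ∑ j, ((z - lam i) ^ 2 * (lam i - lam j) + (z - lam i) * (lam i - lam j) ^ 2) *
        inner ℝ (X i) (U j) ^ 2 ≤ 4 * ((z - lam i) * ‖D i‖ ^ 2) := by
    intro i
    have hz : 0 ≤ z - lam i := sub_nonneg.2 (hlam i)
    have h := mul_le_mul_of_nonneg_left
      (mul_one_add_sum_le_of_commutator hU hz (hcomm i) (hDX i) (hgap i)) hz
    simp only [mul_add, mul_sub, Finset.mul_sum] at h
    simp only [add_mul, Finset.sum_add_distrib, mul_assoc, sq (z - lam i)] at h ⊢
    linarith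
  have cancel : ∑ i, ∑ j, ((z - lam i) ^ 2 * (lam i - lam j) +
      (z - lam i) * (lam i - lam j) ^ 2) * inner ℝ (X i) (U j) ^ 2 = 0 :=
    sum_sum_eq_zero_of_antisymm fun i j => by rw [hX j i]; ring
  have h := Finset.sum_le_sum fun i (_ : i ∈ Finset.univ) => weighted i
  rw [Finset.sum_add_distrib, cancel, add_zero, ← Finset.mul_sum] at h
  exact h

end AbstractYang

/-! ### Compact symmetric operators -/

section CompactSymmetric

variable {𝕜 E : Type*} [RCLike 𝕜] [NormedAddCommGroup E] [InnerProductSpace 𝕜 E] {T : E →L[𝕜] E}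

theorem exists_norm_eq_one_of_hasEigenvalue {τ : 𝕜}
    (hτ : Module.End.HasEigenvalue (T : Module.End 𝕜 E) τ) : ∃ x, ‖x‖ = 1 ∧ T x = τ • x := by
  obtain ⟨v, hv⟩ := hτ.exists_hasEigenvector
  refine ⟨(‖v‖⁻¹ : 𝕜) • v, norm_smul_inv_norm hv.2, ?_⟩
  have hTv : T v = τ • v := hv.apply_eq_smul
  rw [map_smul, hTv, smul_comm]

theorem exists_ne_norm_sub_lt_of_isCompactOperator (hT : IsCompactOperator T) {x : ℕ → E} {r : ℝ}
    (hx : ∀ n, ‖x n‖ ≤ r) {t : ℝ} (ht : 0 < t) : ∃ n m, n ≠ m ∧ ‖T (x n) - T (x m)‖ < t := by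
  have hc := hT.isCompact_closure_image_closedBall (f := (T : E →ₗ[𝕜] E)) r
  obtain ⟨a, -, ψ, hψ, hlim⟩ := hc.tendsto_subseq (x := fun n => T (x n)) fun n =>
    subset_closure ⟨x n, by simpa using hx n, rfl⟩
  obtain ⟨N, hN⟩ := Metric.cauchySeq_iff.1 hlim.cauchySeq t ht
  refine ⟨ψ N, ψ (N + 1), hψ.injective.ne (Nat.succ_ne_self N).symm, ?_⟩
  simpa [dist_eq_norm] using hN N le_rfl (N + 1) (Nat.le_succ N)

theorem norm_le_norm_sub_of_inner_eq_zero {x y : E} (h : inner 𝕜 x y = 0) : ‖x‖ ≤ ‖x - y‖ := by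
  have := norm_add_sq_eq_norm_sq_add_norm_sq_of_inner_eq_zero x (-y) (𝕜 := 𝕜) (by simpa using h)
  rw [← sub_eq_add_neg] at this
  nlinarith [norm_nonneg x, norm_nonneg (x - y), mul_self_nonneg ‖-y‖]

theorem finite_setOf_hasEigenvalue_of_isCompactOperator (hT : IsCompactOperator T)
    (hs : T.IsSymmetric) {t : ℝ} (ht : 0 < t) :
    {τ : 𝕜 | t ≤ ‖τ‖ ∧ Module.End.HasEigenvalue (T : Module.End 𝕜 E) τ}.Finite := by
  refine Set.not_infinite.1 fun hinf => ?_
  let τ := hinf.natEmbedding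
  choose x hx hTx using fun n => exists_norm_eq_one_of_hasEigenvalue (τ n).2.2
  obtain ⟨n, m, hnm, hlt⟩ := exists_ne_norm_sub_lt_of_isCompactOperator hT (fun n => (hx n).le) ht
  have hne : (τ n : 𝕜) ≠ τ m := fun h => hnm (τ.injective (Subtype.ext h))
  have horth : inner 𝕜 (T (x n)) (T (x m)) = 0 := by
    have : inner 𝕜 (x n) (x m) = 0 := hs.orthogonalFamily_eigenspaces hne
      ⟨x n, Module.End.mem_eigenspace_iff.2 (hTx n)⟩ ⟨x m, Module.End.mem_eigenspace_iff.2 (hTx m)⟩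
    rw [hTx, hTx, inner_smul_left, inner_smul_right, this, mul_zero, mul_zero]
  have hsep := norm_le_norm_sub_of_inner_eq_zero horth
  rw [hTx n, norm_smul, hx, mul_one, ← hTx n] at hsep
  exact (hsep.trans_lt hlt).not_ge (τ n).2.1

theorem norm_le_of_forall_hasEigenvalue [CompleteSpace E] (hT : IsCompactOperator T)
    (hs : T.IsSymmetric) {t : ℝ} (ht : 0 ≤ t)
    (h : ∀ τ, Module.End.HasEigenvalue (T : Module.End 𝕜 E) τ → ‖τ‖ ≤ t) : ‖T‖ ≤ t := by
  have hrad : spectralRadius 𝕜 T ≤ ENNReal.ofReal t := by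
    refine iSup₂_le fun τ hτ => ?_
    rw [← enorm_eq_nnnorm, ← ofReal_norm]
    refine ENNReal.ofReal_le_ofReal ?_
    rcases eq_or_ne τ 0 with rfl | hτ0
    · simpa using ht
    · exact h τ ((hT.hasEigenvalue_iff_mem_spectrum hτ0).2 hτ)
  rw [T.spectralRadius_eq_nnnorm hs.isSelfAdjoint] at hrad
  exact (Real.le_toNNReal_iff_coe_le ht).1 (ENNReal.coe_le_coe.1 hrad)

theorem norm_apply_le_of_orthogonal_eigenvectors [CompleteSpace E] (hT : IsCompactOperator T)
    (hs : T.IsSymmetric) {t : ℝ} (ht : 0 ≤ t) {w : E}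
    (hw : ∀ τ : 𝕜, t < ‖τ‖ → ∀ x, T x = τ • x → inner 𝕜 x w = 0) : ‖T w‖ ≤ t * ‖w‖ := by
  let W : Submodule 𝕜 E :=
    (⨆ τ : {τ : 𝕜 // t < ‖τ‖}, Module.End.eigenspace (T : Module.End 𝕜 E) τ)ᗮ
  have mem_W {v : E} : v ∈ W ↔ ∀ τ : 𝕜, t < ‖τ‖ → ∀ x, T x = τ • x → inner 𝕜 x v = 0 := by
    simp only [W, ← Submodule.iInf_orthogonal, Submodule.mem_iInf, Submodule.mem_orthogonal,
      Module.End.mem_eigenspace_iff, Subtype.forall, ContinuousLinearMap.coe_coe]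
  have hinv : ∀ v ∈ W, T v ∈ W := fun v hv => mem_W.2 fun τ hτ x hx => by
    have hsymm : inner 𝕜 (T x) v = inner 𝕜 x (T v) := hs x v
    rw [← hsymm, hx, inner_smul_left, mem_W.1 hv τ hτ x hx, mul_zero]
  let S : W →L[𝕜] W := T.restrict hinv
  have hS : ‖S‖ ≤ t := by
    refine norm_le_of_forall_hasEigenvalue (hT.restrict' hinv) (hs.restrict_invariant hinv) ht
      fun τ hτ => le_of_not_gt fun hlt => ?_
    obtain ⟨v, hv, hTv⟩ := exists_norm_eq_one_of_hasEigenvalue hτ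
    have hvv : inner 𝕜 v v = 0 := mem_W.1 v.2 τ hlt v (congrArg Subtype.val hTv)
    rw [inner_self_eq_zero.1 hvv, norm_zero] at hv
    exact zero_ne_one hv
  exact S.le_of_opNorm_le hS ⟨w, mem_W.2 hw⟩

end CompactSymmetric

/-! ### Square integrable fields -/

section LpFields

variable {α F ι : Type*} [MeasurableSpace α] {μ : Measure α} [Fintype ι] [NormedAddCommGroup F]

/-- Multiplication by the essentially bounded function `g`, as an operator on `L²`. -/
def mulLp [NormedSpace ℝ F] (g : Lp ℝ ∞ μ) : Lp F 2 μ →L[ℝ] Lp F 2 μ :=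
  (ContinuousLinearMap.lsmul ℝ ℝ).holderL μ ∞ 2 2 g

theorem coeFn_mulLp [NormedSpace ℝ F] (g : Lp ℝ ∞ μ) (f : Lp F 2 μ) :
    mulLp g f =ᵐ[μ] fun x => g x • f x :=
  (ContinuousLinearMap.lsmul ℝ ℝ).coeFn_holder g f

theorem inner_mulLp_left [InnerProductSpace ℝ F] (g : Lp ℝ ∞ μ) (f h : Lp F 2 μ) :
    inner ℝ (mulLp g f) h = inner ℝ f (mulLp g h) := by
  rw [L2.inner_def, L2.inner_def]
  refine integral_congr_ae ?_
  filter_upwards [coeFn_mulLp g f, coeFn_mulLp g h] with x hf hh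
  rw [hf, hh, real_inner_smul_left, real_inner_smul_right]

/-- The `i`-th component of a square integrable field. -/
def coordField (i : ι) : Lp (EuclideanSpace ℝ ι) 2 μ →L[ℝ] Lp ℝ 2 μ :=
  (EuclideanSpace.proj i : EuclideanSpace ℝ ι →L[ℝ] ℝ).compLpL 2 μ

theorem coeFn_coordField (i : ι) (f : Lp (EuclideanSpace ℝ ι) 2 μ) :
    coordField i f =ᵐ[μ] fun x => f x i :=
  ContinuousLinearMap.coeFn_compLpL _ f

theorem coordField_mulLp (i : ι) (g : Lp ℝ ∞ μ) (f : Lp (EuclideanSpace ℝ ι) 2 μ) :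
    coordField i (mulLp g f) = mulLp g (coordField i f) := by
  refine Lp.ext ?_
  filter_upwards [coeFn_coordField i f, coeFn_coordField i (mulLp g f), coeFn_mulLp g f,
    coeFn_mulLp g (coordField i f)] with x h1 h2 h3 h4
  rw [h2, h3, h4, h1, PiLp.smul_apply]

theorem norm_sq_eq_sum_coordField (f : Lp (EuclideanSpace ℝ ι) 2 μ) :
    ‖f‖ ^ 2 = ∑ i, ‖coordField i f‖ ^ 2 := by
  simp only [← real_inner_self_eq_norm_sq, L2.inner_def]
  rw [← integral_finsetSum _ fun i _ => L2.integrable_inner _ _]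
  refine integral_congr_ae ?_
  filter_upwards [ae_all_iff.2 fun i => coeFn_coordField i f] with x h
  simp only [h, PiLp.inner_apply]

variable [DecidableEq ι]

/-- The field `f eᵢ` pointing in the `i`-th coordinate direction. -/
def singleField (i : ι) : Lp ℝ 2 μ →L[ℝ] Lp (EuclideanSpace ℝ ι) 2 μ :=
  (ContinuousLinearMap.toSpanSingleton ℝ (EuclideanSpace.single i (1 : ℝ))).compLpL 2 μ

theorem coeFn_singleField (i : ι) (f : Lp ℝ 2 μ) :
    singleField i f =ᵐ[μ] fun x => f x • EuclideanSpace.single i (1 : ℝ) :=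
  ContinuousLinearMap.coeFn_compLpL _ f

theorem inner_singleField_left (i : ι) (f : Lp ℝ 2 μ) (g : Lp (EuclideanSpace ℝ ι) 2 μ) :
    inner ℝ (singleField i f) g = inner ℝ f (coordField i g) := by
  rw [L2.inner_def, L2.inner_def]
  refine integral_congr_ae ?_
  filter_upwards [coeFn_singleField i f, coeFn_coordField i g] with x hf hg
  rw [hf, hg, real_inner_smul_left, EuclideanSpace.inner_single_left]
  simp [mul_comm]

theorem coordField_singleField (i : ι) (f : Lp ℝ 2 μ) : coordField i (singleField i f) = f := by
  refine Lp.ext ?_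
  filter_upwards [coeFn_singleField i f, coeFn_coordField i (singleField i f)] with x hf hg
  rw [hg, hf]
  simp

end LpFields

section Gradient

variable {E : Type*} [NormedAddCommGroup E] [InnerProductSpace ℝ E] [CompleteSpace E] {f : E → ℝ}

theorem continuous_gradient (hf : ContDiff ℝ 1 f) : Continuous (gradient f) :=
  (InnerProductSpace.toDual ℝ E).symm.continuous.comp (hf.continuous_fderiv one_ne_zero)

theorem hasCompactSupport_gradient (hf : HasCompactSupport f) : HasCompactSupport (gradient f) :=
  hf.fderiv (𝕜 := ℝ) |>.comp_left (map_zero _)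

theorem enorm_gradient (x : E) : ‖gradient f x‖ₑ = ‖fderiv ℝ f x‖ₑ := by
  rw [← ofReal_norm, ← ofReal_norm, gradient, LinearIsometryEquiv.norm_map]

theorem gradient_apply_eq_fderiv_single {ι : Type*} [Fintype ι] [DecidableEq ι]
    (f : EuclideanSpace ℝ ι → ℝ) (x : EuclideanSpace ℝ ι) (i : ι) :
    gradient f x i = fderiv ℝ f x (EuclideanSpace.single i 1) := by
  rw [← inner_gradient_left, EuclideanSpace.inner_single_right, one_mul, conj_trivial]

end Gradient

/-! ### Coordinate multiplication on `H¹₀(Ω)` -/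

section TestFunctions

variable {d : ℕ} {Ω : Opens (EuclideanSpace ℝ (Fin d))}

theorem contDiff_one_testFunction (φ : 𝓓(Ω, ℝ)) : ContDiff ℝ 1 φ :=
  φ.contDiff.of_le (mod_cast le_top)

theorem memLp_testFunction (φ : 𝓓(Ω, ℝ)) :
    MemLp φ 2 (volume.restrict (Ω : Set (EuclideanSpace ℝ (Fin d)))) :=
  φ.continuous.memLp_of_hasCompactSupport φ.hasCompactSupport

theorem memLp_gradient_testFunction (φ : 𝓓(Ω, ℝ)) :
    MemLp (gradient φ) 2 (volume.restrict (Ω : Set (EuclideanSpace ℝ (Fin d)))) :=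
  (continuous_gradient (contDiff_one_testFunction φ)).memLp_of_hasCompactSupport
    (hasCompactSupport_gradient φ.hasCompactSupport)

/-- The pair `(φ, ∇φ)` of a test function and its gradient, in `L²(Ω) × L²(Ω; ℝᵈ)`. -/
def testPair (φ : 𝓓(Ω, ℝ)) : L2Pair Ω :=
  WithLp.toLp 2 ((memLp_testFunction φ).toLp, (memLp_gradient_testFunction φ).toLp)

theorem coeFn_testPair_fst (φ : 𝓓(Ω, ℝ)) :
    (testPair φ).fst =ᵐ[volume.restrict (Ω : Set (EuclideanSpace ℝ (Fin d)))] φ :=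
  (memLp_testFunction φ).coeFn_toLp

theorem coeFn_testPair_snd (φ : 𝓓(Ω, ℝ)) :
    (testPair φ).snd =ᵐ[volume.restrict (Ω : Set (EuclideanSpace ℝ (Fin d)))] gradient φ :=
  (memLp_gradient_testFunction φ).coeFn_toLp

theorem mem_testGraph_iff {p : L2Pair Ω} : p ∈ testGraph Ω ↔ ∃ φ : 𝓓(Ω, ℝ), testPair φ = p := by
  constructor
  · rintro ⟨φ, h1, h2⟩
    refine ⟨φ, WithLp.ofLp_injective 2 (Prod.ext ?_ ?_)⟩
    · exact Lp.ext ((coeFn_testPair_fst φ).trans h1.symm)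
    · exact Lp.ext ((coeFn_testPair_snd φ).trans h2.symm)
  · rintro ⟨φ, rfl⟩
    exact ⟨φ, coeFn_testPair_fst φ, coeFn_testPair_snd φ⟩

/-- The product of a test function and the coordinate function `xₐ`. -/
def testFunctionMulCoord (a : Fin d) (φ : 𝓓(Ω, ℝ)) : 𝓓(Ω, ℝ) where
  toFun x := x a * φ x
  contDiff' := ContDiff.mul (EuclideanSpace.proj a : EuclideanSpace ℝ (Fin d) →L[ℝ] ℝ).contDiff
    φ.contDiff
  hasCompactSupport' := φ.hasCompactSupport.mul_left
  tsupport_subset' := tsupport_mul_subset_right.trans φ.tsupport_subset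

theorem gradient_testFunctionMulCoord (a : Fin d) (φ : 𝓓(Ω, ℝ)) (x : EuclideanSpace ℝ (Fin d)) :
    gradient (testFunctionMulCoord a φ) x =
      x a • gradient φ x + φ x • EuclideanSpace.single a (1 : ℝ) := by
  have hcoord := (EuclideanSpace.proj a : EuclideanSpace ℝ (Fin d) →L[ℝ] ℝ).hasFDerivAt (x := x)
  have hφ := ((contDiff_one_testFunction φ).differentiable one_ne_zero x).hasFDerivAt
  have hmul : HasFDerivAt (testFunctionMulCoord a φ) _ x := hcoord.mul hφ
  ext b
  rw [gradient_apply_eq_fderiv_single, hmul.fderiv]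
  simp [gradient_apply_eq_fderiv_single, eq_comm]

theorem integral_testFunction_mul_fderiv (φ ψ : 𝓓(Ω, ℝ)) (v : EuclideanSpace ℝ (Fin d)) :
    ∫ x, φ x * fderiv ℝ ψ x v = -∫ x, fderiv ℝ φ x v * ψ x := by
  have hφ := contDiff_one_testFunction φ
  have hψ := contDiff_one_testFunction ψ
  have hφ' : Continuous fun x => fderiv ℝ φ x v :=
    (hφ.continuous_fderiv one_ne_zero).clm_apply continuous_const
  have hψ' : Continuous fun x => fderiv ℝ ψ x v :=
    (hψ.continuous_fderiv one_ne_zero).clm_apply continuous_const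
  exact integral_mul_fderiv_eq_neg_fderiv_mul_of_integrable
    ((hφ'.mul hψ.continuous).integrable_of_hasCompactSupport ψ.hasCompactSupport.mul_left)
    ((hφ.continuous.mul hψ').integrable_of_hasCompactSupport φ.hasCompactSupport.mul_right)
    ((hφ.continuous.mul hψ.continuous).integrable_of_hasCompactSupport
      φ.hasCompactSupport.mul_right)
    (fun x _ => hφ.differentiable one_ne_zero x) fun x _ => hψ.differentiable one_ne_zero x

theorem inner_testPair_fst_coordField (a : Fin d) (φ ψ : 𝓓(Ω, ℝ)) :
    inner ℝ (testPair φ).fst (coordField a (testPair ψ).snd) =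
      ∫ x, φ x * fderiv ℝ ψ x (EuclideanSpace.single a 1) := by
  have hsupport : ∀ x ∉ (Ω : Set (EuclideanSpace ℝ (Fin d))),
      φ x * fderiv ℝ ψ x (EuclideanSpace.single a 1) = 0 := fun x hx => by
    rw [image_eq_zero_of_notMem_tsupport fun h => hx (φ.tsupport_subset h), zero_mul]
  rw [L2.inner_def, ← setIntegral_eq_integral_of_forall_compl_eq_zero hsupport]
  refine integral_congr_ae ?_
  filter_upwards [coeFn_testPair_fst φ, coeFn_coordField a (testPair ψ).snd,
    coeFn_testPair_snd ψ] with x h1 h2 h3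
  rw [h1, h2, h3, gradient_apply_eq_fderiv_single, RCLike.inner_apply, conj_trivial, mul_comm]

end TestFunctions

section MulCoord

variable {d : ℕ} {Ω : Opens (EuclideanSpace ℝ (Fin d))}

theorem memLp_top_coord (hbdd : Bornology.IsBounded (Ω : Set (EuclideanSpace ℝ (Fin d))))
    (a : Fin d) : MemLp (fun x : EuclideanSpace ℝ (Fin d) => x a) ∞
      (volume.restrict (Ω : Set (EuclideanSpace ℝ (Fin d)))) := by
  obtain ⟨C, hC⟩ := hbdd.exists_norm_le
  refine memLp_top_of_bound (by fun_prop) C ?_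
  filter_upwards [ae_restrict_mem Ω.isOpen.measurableSet] with x hx
  exact (PiLp.norm_apply_le x a).trans (hC x hx)

variable (hbdd : Bornology.IsBounded (Ω : Set (EuclideanSpace ℝ (Fin d)))) (a : Fin d)

/-- Multiplication by the coordinate function `xₐ` on `L²(Ω; F)`. -/
def mulCoord {F : Type*} [NormedAddCommGroup F] [NormedSpace ℝ F] :
    Lp F 2 (volume.restrict (Ω : Set (EuclideanSpace ℝ (Fin d)))) →L[ℝ]
      Lp F 2 (volume.restrict (Ω : Set (EuclideanSpace ℝ (Fin d)))) :=
  mulLp (memLp_top_coord hbdd a).toLp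

theorem coeFn_mulCoord {F : Type*} [NormedAddCommGroup F] [NormedSpace ℝ F]
    (f : Lp F 2 (volume.restrict (Ω : Set (EuclideanSpace ℝ (Fin d))))) :
    mulCoord hbdd a f =ᵐ[volume.restrict (Ω : Set (EuclideanSpace ℝ (Fin d)))]
      fun x => x a • f x := by
  filter_upwards [coeFn_mulLp (memLp_top_coord hbdd a).toLp f,
    (memLp_top_coord hbdd a).coeFn_toLp] with x hx hcoord
  rw [mulCoord, hx, hcoord]

/-- Multiplication of `u` by the coordinate function `xₐ`, as the map
`(u, ∇u) ↦ (xₐ u, xₐ ∇u + u eₐ)`. -/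
def mulCoordPair : L2Pair Ω →L[ℝ] L2Pair Ω :=
  ((WithLp.prodContinuousLinearEquiv 2 ℝ (L2 Ω) (L2Vec Ω)).symm : _ →L[ℝ] L2Pair Ω) ∘L
    ((mulCoord hbdd a ∘L WithLp.fstL 2 ℝ (L2 Ω) (L2Vec Ω)).prod
      (mulCoord hbdd a ∘L WithLp.sndL 2 ℝ (L2 Ω) (L2Vec Ω) +
        singleField a ∘L WithLp.fstL 2 ℝ (L2 Ω) (L2Vec Ω)))

theorem mulCoordPair_testPair (φ : 𝓓(Ω, ℝ)) :
    mulCoordPair hbdd a (testPair φ) = testPair (testFunctionMulCoord a φ) := by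
  refine WithLp.ofLp_injective 2 (Prod.ext (Lp.ext ?_) (Lp.ext ?_))
  · filter_upwards [coeFn_mulCoord hbdd a (testPair φ).fst, coeFn_testPair_fst φ,
      coeFn_testPair_fst (testFunctionMulCoord a φ)] with x h1 h2 h3
    exact h1.trans ((congrArg (x a • ·) h2).trans h3.symm)
  · filter_upwards [coeFn_mulCoord hbdd a (testPair φ).snd, coeFn_testPair_fst φ,
      coeFn_testPair_snd φ, coeFn_testPair_snd (testFunctionMulCoord a φ),
      coeFn_singleField a (testPair φ).fst,
      Lp.coeFn_add (mulCoord hbdd a (testPair φ).snd) (singleField a (testPair φ).fst)]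
      with x hmul hφ hgrad htest hsingle hadd
    refine hadd.trans ?_
    rw [Pi.add_apply, hmul, hsingle, hφ, hgrad, ← gradient_testFunctionMulCoord]
    exact htest.symm

theorem mulCoordPair_mem_H10 {u : L2Pair Ω} (hu : u ∈ H10 Ω) : mulCoordPair hbdd a u ∈ H10 Ω := by
  refine map_mem_closure (mulCoordPair hbdd a).continuous hu fun p hp => ?_
  obtain ⟨φ, rfl⟩ := mem_testGraph_iff.1 hp
  exact mem_testGraph_iff.2 ⟨testFunctionMulCoord a φ, (mulCoordPair_testPair hbdd a φ).symm⟩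

end MulCoord

namespace H10

variable {d : ℕ} {Ω : Opens (EuclideanSpace ℝ (Fin d))}

instance : CompleteSpace (H10 Ω) :=
  (testGraph Ω).isClosed_topologicalClosure.completeSpace_coe

/-- The inclusion `H¹₀(Ω) → L²(Ω)`. -/
def toL2 : H10 Ω →L[ℝ] L2 Ω :=
  WithLp.fstL 2 ℝ (L2 Ω) (L2Vec Ω) ∘L (H10 Ω).subtypeL

/-- The weak gradient `H¹₀(Ω) → L²(Ω; ℝᵈ)`. -/
def grad : H10 Ω →L[ℝ] L2Vec Ω :=
  WithLp.sndL 2 ℝ (L2 Ω) (L2Vec Ω) ∘L (H10 Ω).subtypeL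

/-- The weak partial derivative `∂ₐ : H¹₀(Ω) → L²(Ω)`. -/
def partialDeriv (a : Fin d) : H10 Ω →L[ℝ] L2 Ω :=
  coordField a ∘L grad

theorem inner_eq (u v : H10 Ω) :
    inner ℝ u v = inner ℝ (toL2 u) (toL2 v) + inner ℝ (grad u) (grad v) :=
  WithLp.prod_inner_apply _ _

theorem inner_smul_left (c : ℝ) (u v : H10 Ω) : inner ℝ (c • u) v = c * inner ℝ u v := by
  rw [inner_eq, inner_eq, map_smul, map_smul, real_inner_smul_left, real_inner_smul_left, mul_add]

theorem norm_sq_eq (u : H10 Ω) : ‖u‖ ^ 2 = ‖toL2 u‖ ^ 2 + ‖grad u‖ ^ 2 := by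
  simp only [← real_inner_self_eq_norm_sq, inner_eq]

theorem norm_grad_sq (u : H10 Ω) : ‖grad u‖ ^ 2 = ∑ a, ‖partialDeriv a u‖ ^ 2 :=
  norm_sq_eq_sum_coordField _

/-- A test function as an element of `H¹₀(Ω)`. -/
def ofTestFunction (φ : 𝓓(Ω, ℝ)) : H10 Ω :=
  ⟨testPair φ, (testGraph Ω).le_topologicalClosure (mem_testGraph_iff.2 ⟨φ, rfl⟩)⟩

theorem denseRange_ofTestFunction : DenseRange (ofTestFunction (Ω := Ω)) := by
  intro u
  rw [Topology.IsInducing.subtypeVal.closure_eq_preimage_closure_image, ← Set.range_comp]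
  refine closure_mono (fun p hp => ?_) u.2
  exact mem_testGraph_iff.1 hp

theorem inner_toL2_partialDeriv (a : Fin d) (u v : H10 Ω) :
    inner ℝ (toL2 u) (partialDeriv a v) = -inner ℝ (partialDeriv a u) (toL2 v) := by
  refine denseRange_ofTestFunction.induction_on₂
    (p := fun u v => inner ℝ (toL2 u) (partialDeriv a v) = -inner ℝ (partialDeriv a u) (toL2 v))
    (isClosed_eq (by fun_prop) (by fun_prop)) (fun φ ψ => ?_) u v
  calc inner ℝ (testPair φ).fst (coordField a (testPair ψ).snd)
      = -∫ x, fderiv ℝ φ x (EuclideanSpace.single a 1) * ψ x := by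
        rw [inner_testPair_fst_coordField, integral_testFunction_mul_fderiv]
    _ = -inner ℝ (coordField a (testPair φ).snd) (testPair ψ).fst := by
        rw [real_inner_comm, inner_testPair_fst_coordField]
        simp only [mul_comm]

variable (hbdd : Bornology.IsBounded (Ω : Set (EuclideanSpace ℝ (Fin d)))) (a : Fin d)

/-- Multiplication by the coordinate function `xₐ` on `H¹₀(Ω)`. -/
def mulCoord : H10 Ω →L[ℝ] H10 Ω :=
  (mulCoordPair hbdd a).restrict fun _ => mulCoordPair_mem_H10 hbdd a

theorem toL2_mulCoord (u : H10 Ω) : toL2 (mulCoord hbdd a u) = _root_.mulCoord hbdd a (toL2 u) :=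
  rfl

theorem grad_mulCoord (u : H10 Ω) :
    grad (mulCoord hbdd a u) = _root_.mulCoord hbdd a (grad u) + singleField a (toL2 u) :=
  rfl

theorem inner_toL2_mulCoord (u v : H10 Ω) :
    inner ℝ (toL2 (mulCoord hbdd a u)) (toL2 v) = inner ℝ (toL2 u) (toL2 (mulCoord hbdd a v)) :=
  inner_mulLp_left _ _ _

theorem partialDeriv_mulCoord (u : H10 Ω) : partialDeriv a (mulCoord hbdd a u) =
    _root_.mulCoord hbdd a (partialDeriv a u) + toL2 u := by
  rw [partialDeriv, ContinuousLinearMap.comp_apply, grad_mulCoord, map_add, coordField_singleField,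
    _root_.mulCoord, coordField_mulLp, ContinuousLinearMap.comp_apply, _root_.mulCoord]

theorem neg_two_mul_inner_partialDeriv_mulCoord (u : H10 Ω) :
    -2 * inner ℝ (partialDeriv a u) (toL2 (mulCoord hbdd a u)) = ‖toL2 u‖ ^ 2 := by
  have h := inner_toL2_partialDeriv a u (mulCoord hbdd a u)
  have hsymm : inner ℝ (toL2 u) (_root_.mulCoord hbdd a (partialDeriv a u)) =
      inner ℝ (partialDeriv a u) (toL2 (mulCoord hbdd a u)) := by
    rw [real_inner_comm, toL2_mulCoord]
    exact inner_mulLp_left _ _ _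
  rw [partialDeriv_mulCoord, inner_add_right, hsymm, real_inner_self_eq_norm_sq] at h
  linarith

/-- The commutator identity `[-Δ, xₐ] = -2 ∂ₐ`. -/
theorem inner_grad_mulCoord (u v : H10 Ω) : inner ℝ (grad (mulCoord hbdd a u)) (grad v) =
    inner ℝ (grad u) (grad (mulCoord hbdd a v)) - 2 * inner ℝ (partialDeriv a u) (toL2 v) := by
  have hsymm : inner ℝ (_root_.mulCoord hbdd a (grad u)) (grad v) =
      inner ℝ (grad u) (_root_.mulCoord hbdd a (grad v)) := inner_mulLp_left _ _ _
  have hleft : inner ℝ (singleField a (toL2 u)) (grad v) = -inner ℝ (partialDeriv a u) (toL2 v) :=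
    (inner_singleField_left a _ _).trans (inner_toL2_partialDeriv a u v)
  have hright : inner ℝ (grad u) (singleField a (toL2 v)) =
      inner ℝ (partialDeriv a u) (toL2 v) := by
    rw [real_inner_comm, inner_singleField_left, real_inner_comm]
    rfl
  rw [grad_mulCoord, grad_mulCoord, inner_add_left, inner_add_right, hsymm, hleft, hright]
  ring

end H10

/-! ### Compactness of the embedding of `H¹₀(Ω)` into `L²(Ω)` -/

section TranslationEstimate

theorem eLpNorm_two_sq {α F : Type*} [MeasurableSpace α] {μ : Measure α} [NormedAddCommGroup F]
    {f : α → F} : eLpNorm f 2 μ ^ 2 = ∫⁻ x, ‖f x‖ₑ ^ 2 ∂μ := by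
  simpa using eLpNorm_nnreal_pow_eq_lintegral (f := f) (μ := μ) (p := 2) two_ne_zero

theorem enorm_integral_sq_le {α F : Type*} [MeasurableSpace α] {μ : Measure α}
    [IsProbabilityMeasure μ] [NormedAddCommGroup F] [NormedSpace ℝ F] {f : α → F}
    (hf : AEStronglyMeasurable f μ) : ‖∫ x, f x ∂μ‖ₑ ^ 2 ≤ ∫⁻ x, ‖f x‖ₑ ^ 2 ∂μ := by
  calc ‖∫ x, f x ∂μ‖ₑ ^ 2 ≤ eLpNorm f 1 μ ^ 2 := by
        gcongr
        exact (enorm_integral_le_lintegral_enorm f).trans eLpNorm_one_eq_lintegral_enorm.ge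
    _ ≤ eLpNorm f 2 μ ^ 2 := by
        gcongr
        exact eLpNorm_le_eLpNorm_of_exponent_le one_le_two hf
    _ = ∫⁻ x, ‖f x‖ₑ ^ 2 ∂μ := eLpNorm_two_sq

theorem enorm_average_sub_sq_le {α F : Type*} [MeasurableSpace α] {μ : Measure α}
    [IsFiniteMeasure μ] [NeZero μ] [NormedAddCommGroup F] [NormedSpace ℝ F] [CompleteSpace F]
    {f : α → F} (hf : Integrable f μ) (c : F) :
    ‖⨍ x, f x ∂μ - c‖ₑ ^ 2 ≤ ⨍⁻ x, ‖f x - c‖ₑ ^ 2 ∂μ := by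
  have hint : Integrable f ((μ Set.univ)⁻¹ • μ) :=
    hf.smul_measure (ENNReal.inv_ne_top.2 (NeZero.ne _))
  have hc : ⨍ x, f x ∂μ - c = ⨍ x, (f x - c) ∂μ := by
    rw [average, average, integral_sub hint (integrable_const c), integral_const, probReal_univ,
      one_smul]
  rw [hc]
  exact enorm_integral_sq_le (hint.sub (integrable_const c)).aestronglyMeasurable

variable {E F : Type*} [NormedAddCommGroup E] [NormedSpace ℝ E] [NormedAddCommGroup F]
  [NormedSpace ℝ F] [CompleteSpace F] {f : E → F}

theorem enorm_add_sub_sq_le_lintegral (hf : ContDiff ℝ 1 f) (x y : E) :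
    ‖f (x + y) - f x‖ₑ ^ 2 ≤
      ‖y‖ₑ ^ 2 * ∫⁻ t in Set.Ioc (0 : ℝ) 1, ‖fderiv ℝ f (x + t • y)‖ₑ ^ 2 := by
  have hderiv : ∀ t ∈ Set.uIcc (0 : ℝ) 1,
      HasDerivAt (fun t : ℝ => f (x + t • y)) (fderiv ℝ f (x + t • y) y) t := fun t _ => by
    have hline : HasDerivAt (fun t : ℝ => x + t • y) y t := by
      simpa using ((hasDerivAt_id t).smul_const y).const_add x
    exact (hf.differentiable one_ne_zero _).hasFDerivAt.comp_hasDerivAt t hline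
  have hcont : Continuous fun t : ℝ => fderiv ℝ f (x + t • y) :=
    (hf.continuous_fderiv one_ne_zero).comp (by fun_prop)
  have hcont' : Continuous fun t : ℝ => fderiv ℝ f (x + t • y) y :=
    hcont.clm_apply continuous_const
  have hftc : f (x + y) - f x = ∫ t in Set.Ioc (0 : ℝ) 1, fderiv ℝ f (x + t • y) y := by
    rw [← intervalIntegral.integral_of_le zero_le_one,
      intervalIntegral.integral_eq_sub_of_hasDerivAt hderiv (hcont'.intervalIntegrable _ _)]
    simp only [one_smul, zero_smul, add_zero]
  have : IsProbabilityMeasure (volume.restrict (Set.Ioc (0 : ℝ) 1)) := ⟨by simp⟩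
  rw [hftc, ← lintegral_const_mul _ (hcont.enorm.measurable.pow_const 2)]
  refine (enorm_integral_sq_le hcont'.aestronglyMeasurable).trans (lintegral_mono fun t => ?_)
  rw [← mul_pow, mul_comm]
  gcongr
  exact ContinuousLinearMap.le_opENorm _ _

variable [MeasurableSpace E] [BorelSpace E] {μ : Measure E} [SFinite μ] [μ.IsAddLeftInvariant]

theorem lintegral_enorm_add_sub_sq_le (hf : ContDiff ℝ 1 f) (y : E) :
    ∫⁻ x, ‖f (x + y) - f x‖ₑ ^ 2 ∂μ ≤ ‖y‖ₑ ^ 2 * ∫⁻ x, ‖fderiv ℝ f x‖ₑ ^ 2 ∂μ := by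
  have hderiv : Continuous fun p : E × ℝ => fderiv ℝ f (p.1 + p.2 • y) :=
    (hf.continuous_fderiv one_ne_zero).comp (by fun_prop)
  calc ∫⁻ x, ‖f (x + y) - f x‖ₑ ^ 2 ∂μ
      ≤ ∫⁻ x, (‖y‖ₑ ^ 2 * ∫⁻ t in Set.Ioc (0 : ℝ) 1, ‖fderiv ℝ f (x + t • y)‖ₑ ^ 2) ∂μ :=
        lintegral_mono fun x => enorm_add_sub_sq_le_lintegral hf x y
    _ = ‖y‖ₑ ^ 2 * ∫⁻ t in Set.Ioc (0 : ℝ) 1, ∫⁻ x, ‖fderiv ℝ f (x + t • y)‖ₑ ^ 2 ∂μ := by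
        rw [lintegral_const_mul' _ _ (by finiteness),
          lintegral_lintegral_swap (hderiv.enorm.measurable.pow_const 2).aemeasurable]
    _ = ‖y‖ₑ ^ 2 * ∫⁻ x, ‖fderiv ℝ f x‖ₑ ^ 2 ∂μ := by
        simp only [lintegral_add_right_eq_self fun x => ‖fderiv ℝ f x‖ₑ ^ 2]
        simp

theorem lintegral_enorm_average_sub_sq_le [SecondCountableTopology E]
    (hf : ContDiff ℝ 1 f) (hint : Integrable f μ) {Q : E → Set E} {B : Set E} {m r : ℝ≥0∞}
    (hm : m ≠ 0) (hm' : m ≠ ∞) (hQ : ∀ x, MeasurableSet (Q x)) (hQm : ∀ x, μ (Q x) = m)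
    (hB : MeasurableSet B) (hBr : ∀ z ∈ B, ‖z‖ₑ ≤ r) (hQB : ∀ x, ∀ y ∈ Q x, y - x ∈ B) :
    ∫⁻ x, ‖⨍ y in Q x, f y ∂μ - f x‖ₑ ^ 2 ∂μ ≤
      μ B / m * r ^ 2 * ∫⁻ x, ‖fderiv ℝ f x‖ₑ ^ 2 ∂μ := by
  have hcont : Continuous fun p : E × E => f (p.1 + p.2) - f p.1 :=
    (hf.continuous.comp (by fun_prop)).sub (hf.continuous.comp continuous_fst)
  have hshift (x : E) : ∫⁻ y in Q x, ‖f y - f x‖ₑ ^ 2 ∂μ ≤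
      ∫⁻ z in B, ‖f (x + z) - f x‖ₑ ^ 2 ∂μ := by
    rw [← lintegral_indicator (hQ x), ← lintegral_indicator hB, ← lintegral_add_left_eq_self _ x]
    refine lintegral_mono fun z => Set.indicator_apply_le' (fun hz => ?_) fun _ => zero_le
    rw [Set.indicator_of_mem (by simpa using hQB x _ hz)]
  have havg (x : E) : ‖⨍ y in Q x, f y ∂μ - f x‖ₑ ^ 2 ≤
      m⁻¹ * ∫⁻ z in B, ‖f (x + z) - f x‖ₑ ^ 2 ∂μ := by
    have : IsFiniteMeasure (μ.restrict (Q x)) := ⟨by simpa [hQm] using hm'.lt_top⟩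
    have : NeZero (μ.restrict (Q x)) := ⟨by simpa [← Measure.measure_univ_eq_zero, hQm] using hm⟩
    refine (enorm_average_sub_sq_le hint.restrict (f x)).trans ?_
    rw [setLAverage_eq, hQm, ENNReal.div_eq_inv_mul]
    exact mul_le_mul_right (hshift x) _
  calc ∫⁻ x, ‖⨍ y in Q x, f y ∂μ - f x‖ₑ ^ 2 ∂μ
      ≤ ∫⁻ x, m⁻¹ * ∫⁻ z in B, ‖f (x + z) - f x‖ₑ ^ 2 ∂μ ∂μ := lintegral_mono havg
    _ = m⁻¹ * ∫⁻ z in B, ∫⁻ x, ‖f (x + z) - f x‖ₑ ^ 2 ∂μ ∂μ := by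
        rw [lintegral_const_mul' _ _ (ENNReal.inv_ne_top.2 hm),
          lintegral_lintegral_swap (hcont.enorm.measurable.pow_const 2).aemeasurable]
    _ ≤ m⁻¹ * ∫⁻ _ in B, r ^ 2 * ∫⁻ x, ‖fderiv ℝ f x‖ₑ ^ 2 ∂μ ∂μ := by
        gcongr m⁻¹ * ?_
        refine setLIntegral_mono measurable_const fun z hz => ?_
        exact (lintegral_enorm_add_sub_sq_le hf z).trans (by gcongr; exact hBr z hz)
    _ = μ B / m * r ^ 2 * ∫⁻ x, ‖fderiv ℝ f x‖ₑ ^ 2 ∂μ := by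
        rw [setLIntegral_const, ENNReal.div_eq_inv_mul]
        ring

end TranslationEstimate

section GridAverage

variable {d : ℕ} (n : ℕ) [NeZero n]

/-- The cells of the cubic grid of mesh size `1 / n`; the cell with index `ν` has the corners
`ν / n` and `(ν + 1) / n`. -/
def gridCell (ν : Fin d → ℤ) : Set (EuclideanSpace ℝ (Fin d)) :=
  WithLp.ofLp ⁻¹' (BoxIntegral.unitPartition.box n ν : Set (Fin d → ℝ))

/-- The index of the grid cell that contains `x`. -/
def gridIndex (x : EuclideanSpace ℝ (Fin d)) : Fin d → ℤ :=
  BoxIntegral.unitPartition.index n x.ofLp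

variable {n}

theorem mem_gridCell_iff {ν : Fin d → ℤ} {x : EuclideanSpace ℝ (Fin d)} :
    x ∈ gridCell n ν ↔ gridIndex n x = ν :=
  BoxIntegral.unitPartition.mem_box_iff_index

theorem measurableSet_gridCell (ν : Fin d → ℤ) : MeasurableSet (gridCell n ν) :=
  (BoxIntegral.Box.measurableSet_coe _).preimage (by fun_prop)

theorem volume_gridCell (ν : Fin d → ℤ) :
    volume (gridCell n ν) = ENNReal.ofReal ((1 / n) ^ d) := by
  rw [gridCell, (PiLp.volume_preserving_ofLp (Fin d)).measure_preimage
    (BoxIntegral.Box.measurableSet_coe _).nullMeasurableSet, BoxIntegral.unitPartition.volume_box,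
    ENNReal.ofReal_pow (by positivity), ENNReal.ofReal_div_of_pos (by simpa using NeZero.pos n)]
  simp [ENNReal.inv_pow]

theorem norm_sub_le_of_mem_gridCell {ν : Fin d → ℤ} {x y : EuclideanSpace ℝ (Fin d)}
    (hx : x ∈ gridCell n ν) (hy : y ∈ gridCell n ν) : ‖y - x‖ ≤ 1 / n * √d := by
  have hx' := BoxIntegral.unitPartition.mem_box_iff.1 hx
  have hy' := BoxIntegral.unitPartition.mem_box_iff.1 hy
  have hcoord (i : Fin d) : ‖(y - x) i‖ ^ 2 ≤ (1 / n : ℝ) ^ 2 := by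
    have := hx' i
    have := hy' i
    rw [add_div] at *
    rw [Real.norm_eq_abs]
    gcongr
    rw [PiLp.sub_apply, abs_le]
    constructor <;> linarith
  rw [EuclideanSpace.norm_eq]
  refine Real.sqrt_le_iff.2 ⟨by positivity, (Finset.sum_le_sum fun i _ => hcoord i).trans ?_⟩
  rw [mul_pow, Real.sq_sqrt d.cast_nonneg]
  simp [mul_comm]

theorem finite_image_gridIndex {s : Set (EuclideanSpace ℝ (Fin d))} (hs : Bornology.IsBounded s) :
    (gridIndex n '' s).Finite := by
  have hbdd : Bornology.IsBounded (WithLp.ofLp '' s) :=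
    (PiLp.lipschitzWith_ofLp 2 _).isBounded_image hs
  obtain ⟨B, hB, hsB⟩ := BoxIntegral.le_hasIntegralVertices_of_isBounded hbdd
  refine (BoxIntegral.unitPartition.admissibleIndex n B).finite_toSet.subset ?_
  rintro _ ⟨x, hx, rfl⟩
  exact BoxIntegral.unitPartition.mem_admissibleIndex_of_mem_box n hB (hsB ⟨x, hx, rfl⟩)

theorem lintegral_enorm_average_gridCell_sub_sq_le {F : Type*} [NormedAddCommGroup F]
    [NormedSpace ℝ F] [CompleteSpace F] {f : EuclideanSpace ℝ (Fin d) → F} (hf : ContDiff ℝ 1 f)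
    (hint : Integrable f) :
    ∫⁻ x, ‖(⨍ y in gridCell n (gridIndex n x), f y) - f x‖ₑ ^ 2 ≤
      volume (Metric.closedBall (0 : EuclideanSpace ℝ (Fin d)) √d) *
        ENNReal.ofReal (1 / n * √d) ^ 2 * ∫⁻ x, ‖fderiv ℝ f x‖ₑ ^ 2 := by
  have hpos : ENNReal.ofReal ((1 / n) ^ d) ≠ 0 := by
    have := NeZero.pos n
    exact (ENNReal.ofReal_pos.2 (by positivity)).ne'
  have hball : volume (Metric.closedBall (0 : EuclideanSpace ℝ (Fin d)) (1 / n * √d)) /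
      ENNReal.ofReal ((1 / n) ^ d) =
        volume (Metric.closedBall (0 : EuclideanSpace ℝ (Fin d)) √d) := by
    rw [Measure.addHaar_closedBall_mul _ _ (by positivity) (by positivity),
      finrank_euclideanSpace_fin, mul_comm, ENNReal.mul_div_cancel_right hpos ENNReal.ofReal_ne_top]
  rw [← hball]
  refine lintegral_enorm_average_sub_sq_le hf hint hpos ENNReal.ofReal_ne_top
    (fun x => measurableSet_gridCell (gridIndex n x)) (fun x => volume_gridCell _)
    Metric.isClosed_closedBall.measurableSet
    (fun z hz => ?_) fun x y hy => ?_
  · rw [← ofReal_norm]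
    exact ENNReal.ofReal_le_ofReal (mem_closedBall_zero_iff.1 hz)
  · exact mem_closedBall_zero_iff.2 (norm_sub_le_of_mem_gridCell (mem_gridCell_iff.2 rfl) hy)

variable {Ω : Opens (EuclideanSpace ℝ (Fin d))}

/-- The indicator function of a grid cell. -/
def gridIndicator (Ω : Opens (EuclideanSpace ℝ (Fin d))) (n : ℕ) [NeZero n]
    (ν : Fin d → ℤ) : L2 Ω :=
  indicatorConstLp 2 (measurableSet_gridCell (n := n) ν)
    (ne_top_of_le_ne_top (by rw [volume_gridCell]; exact ENNReal.ofReal_ne_top)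
      (Measure.restrict_apply_le _ _)) (1 : ℝ)

/-- The operator that replaces a function by its averages over the grid cells with index in `S`. -/
def gridAverage (Ω : Opens (EuclideanSpace ℝ (Fin d))) (n : ℕ) [NeZero n]
    (S : Finset (Fin d → ℤ)) : L2 Ω →L[ℝ] L2 Ω :=
  ∑ ν ∈ S, ((volume.real (gridCell n ν))⁻¹ • innerSL ℝ (gridIndicator Ω n ν)).smulRight
    (gridIndicator Ω n ν)

theorem isCompactOperator_gridAverage (S : Finset (Fin d → ℤ)) :
    IsCompactOperator (gridAverage Ω n S) := by
  suffices gridAverage Ω n S ∈ compactOperator (RingHom.id ℝ) (L2 Ω) (L2 Ω) from this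
  refine Submodule.sum_mem _ fun ν _ => ?_
  exact (isCompactOperator_of_locallyCompactSpace_dom
    ((volume.real (gridCell n ν))⁻¹ • innerSL ℝ (gridIndicator Ω n ν))).clm_comp
    (ContinuousLinearMap.toSpanSingleton ℝ (gridIndicator Ω n ν))

theorem inner_gridIndicator_testPair (ν : Fin d → ℤ) (φ : 𝓓(Ω, ℝ)) :
    inner ℝ (gridIndicator Ω n ν) (testPair φ).fst = ∫ y in gridCell n ν, φ y := by
  have hsupport : ∀ x ∉ (Ω : Set (EuclideanSpace ℝ (Fin d))), φ x = 0 := fun x hx =>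
    image_eq_zero_of_notMem_tsupport fun h => hx (φ.tsupport_subset h)
  rw [gridIndicator, L2.inner_indicatorConstLp_one,
    setIntegral_congr_ae (measurableSet_gridCell ν)
      ((coeFn_testPair_fst φ).mono fun x hx _ => hx),
    Measure.restrict_restrict (measurableSet_gridCell ν), Set.inter_comm,
    ← Measure.restrict_restrict Ω.isOpen.measurableSet]
  exact setIntegral_eq_integral_of_forall_compl_eq_zero hsupport

theorem coeFn_gridAverage_testPair (φ : 𝓓(Ω, ℝ)) {S : Finset (Fin d → ℤ)}
    (hS : ∀ x ∈ Ω, gridIndex n x ∈ S) :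
    gridAverage Ω n S (testPair φ).fst =ᵐ[volume.restrict (Ω : Set (EuclideanSpace ℝ (Fin d)))]
      fun x => ⨍ y in gridCell n (gridIndex n x), φ y := by
  have happ : gridAverage Ω n S (testPair φ).fst =
      ∑ ν ∈ S, (⨍ y in gridCell n ν, φ y) • gridIndicator Ω n ν := by
    simp only [gridAverage, sum_apply, ContinuousLinearMap.smulRight_apply,
      smul_apply, innerSL_apply_apply, inner_gridIndicator_testPair, setAverage_eq]
  have hind : ∀ᵐ x ∂(volume.restrict (Ω : Set (EuclideanSpace ℝ (Fin d)))), ∀ ν,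
      gridIndicator Ω n ν x = (gridCell n ν).indicator (fun _ => (1 : ℝ)) x :=
    ae_all_iff.2 fun _ => indicatorConstLp_coeFn
  have hsmul : ∀ᵐ x ∂(volume.restrict (Ω : Set (EuclideanSpace ℝ (Fin d)))), ∀ ν,
      ((⨍ y in gridCell n ν, φ y) • gridIndicator Ω n ν : L2 Ω) x =
        (⨍ y in gridCell n ν, φ y) * gridIndicator Ω n ν x :=
    ae_all_iff.2 fun _ => Lp.coeFn_smul _ _
  rw [happ]
  filter_upwards [hind, hsmul, ae_restrict_mem Ω.isOpen.measurableSet,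
    Lp.coeFn_finsetSum S (fun ν => (⨍ y in gridCell n ν, φ y) • gridIndicator Ω n ν)]
    with x h1 h2 hx hsum
  rw [hsum, Finset.sum_apply, Finset.sum_eq_single_of_mem _ (hS x hx)]
  · rw [h2, h1, Set.indicator_of_mem (mem_gridCell_iff.2 rfl), mul_one]
  · intro ν _ hν
    rw [h2, h1, Set.indicator_of_notMem (fun hx => hν (mem_gridCell_iff.1 hx).symm), mul_zero]

theorem enorm_gridAverage_testPair_sub_sq_le (φ : 𝓓(Ω, ℝ)) {S : Finset (Fin d → ℤ)}
    (hS : ∀ x ∈ Ω, gridIndex n x ∈ S) :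
    ‖gridAverage Ω n S (testPair φ).fst - (testPair φ).fst‖ₑ ^ 2 ≤
      volume (Metric.closedBall (0 : EuclideanSpace ℝ (Fin d)) √d) *
        ENNReal.ofReal (1 / n * √d) ^ 2 * ‖(testPair φ).snd‖ₑ ^ 2 := by
  have hgrad : ∫⁻ x, ‖fderiv ℝ φ x‖ₑ ^ 2 = ‖(testPair φ).snd‖ₑ ^ 2 := by
    rw [Lp.enorm_def, eLpNorm_two_sq, ← setLIntegral_eq_of_support_subset
      (s := (Ω : Set (EuclideanSpace ℝ (Fin d))))]
    · refine lintegral_congr_ae ?_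
      filter_upwards [coeFn_testPair_snd φ] with x hx
      rw [hx, enorm_gradient]
    · refine Function.support_subset_iff'.2 fun x hx => ?_
      have hx' : x ∉ tsupport φ := fun h => hx (φ.tsupport_subset h)
      rw [fderiv_of_notMem_tsupport ℝ hx']
      exact (congrArg (· ^ 2) (enorm_zero (E := EuclideanSpace ℝ (Fin d) →L[ℝ] ℝ))).trans
        (zero_pow two_ne_zero)
  calc ‖gridAverage Ω n S (testPair φ).fst - (testPair φ).fst‖ₑ ^ 2
      = ∫⁻ x in (Ω : Set (EuclideanSpace ℝ (Fin d))),
          ‖(⨍ y in gridCell n (gridIndex n x), φ y) - φ x‖ₑ ^ 2 := by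
        rw [Lp.enorm_def, eLpNorm_two_sq]
        refine lintegral_congr_ae ?_
        filter_upwards [Lp.coeFn_sub (gridAverage Ω n S (testPair φ).fst) (testPair φ).fst,
          coeFn_gridAverage_testPair φ hS, coeFn_testPair_fst φ] with x h1 h2 h3
        rw [h1, Pi.sub_apply, h2, h3]
    _ ≤ ∫⁻ x, ‖(⨍ y in gridCell n (gridIndex n x), φ y) - φ x‖ₑ ^ 2 :=
        setLIntegral_le_lintegral _ _
    _ ≤ _ := by
        rw [← hgrad]
        exact lintegral_enorm_average_gridCell_sub_sq_le (contDiff_one_testFunction φ)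
          (φ.continuous.integrable_of_hasCompactSupport φ.hasCompactSupport)

end GridAverage

section Rellich

variable {d : ℕ} {Ω : Opens (EuclideanSpace ℝ (Fin d))}

theorem H10.norm_gridAverage_sub_sq_le {n : ℕ} [NeZero n] {S : Finset (Fin d → ℤ)}
    (hS : ∀ x ∈ Ω, gridIndex n x ∈ S) (u : H10 Ω) :
    ‖gridAverage Ω n S (toL2 u) - toL2 u‖ ^ 2 ≤
      volume.real (Metric.closedBall (0 : EuclideanSpace ℝ (Fin d)) √d) * (1 / n * √d) ^ 2 *
        ‖grad u‖ ^ 2 := by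
  refine denseRange_ofTestFunction.induction_on u
    (isClosed_le (by fun_prop) (by fun_prop)) fun φ => ?_
  have hfin : volume (Metric.closedBall (0 : EuclideanSpace ℝ (Fin d)) √d) *
      ENNReal.ofReal (1 / n * √d) ^ 2 * ‖(testPair φ).snd‖ₑ ^ 2 ≠ ∞ :=
    ENNReal.mul_ne_top
      (ENNReal.mul_ne_top measure_closedBall_lt_top.ne (ENNReal.pow_ne_top ENNReal.ofReal_ne_top))
      (ENNReal.pow_ne_top enorm_ne_top)
  have h := ENNReal.toReal_mono hfin (enorm_gridAverage_testPair_sub_sq_le φ hS)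
  rw [ENNReal.toReal_mul, ENNReal.toReal_mul, ENNReal.toReal_pow, ENNReal.toReal_pow,
    ENNReal.toReal_pow, toReal_enorm, toReal_enorm, ENNReal.toReal_ofReal (by positivity)] at h
  exact h

theorem H10.norm_gridAverage_comp_toL2_sub_le {n : ℕ} [NeZero n] {S : Finset (Fin d → ℤ)}
    (hS : ∀ x ∈ Ω, gridIndex n x ∈ S) :
    ‖gridAverage Ω n S ∘L toL2 - toL2‖ ≤
      √(volume.real (Metric.closedBall (0 : EuclideanSpace ℝ (Fin d)) √d)) * (1 / n * √d) := by
  refine ContinuousLinearMap.opNorm_le_bound _ (by positivity) fun u => ?_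
  refine le_of_sq_le_sq ((norm_gridAverage_sub_sq_le hS u).trans ?_) (by positivity)
  rw [mul_pow _ ‖u‖, mul_pow √(volume.real _), Real.sq_sqrt measureReal_nonneg]
  refine mul_le_mul_of_nonneg_left ?_ (by positivity)
  rw [norm_sq_eq]
  exact le_add_of_nonneg_left (sq_nonneg _)

theorem H10.isCompactOperator_toL2
    (hbdd : Bornology.IsBounded (Ω : Set (EuclideanSpace ℝ (Fin d)))) :
    IsCompactOperator (toL2 (Ω := Ω)) := by
  let S (n : ℕ) : Finset (Fin d → ℤ) := (finite_image_gridIndex (n := n + 1) hbdd).toFinset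
  have hS (n : ℕ) (x) (hx : x ∈ Ω) : gridIndex (n + 1) x ∈ S n :=
    (Set.Finite.mem_toFinset _).2 (Set.mem_image_of_mem _ hx)
  refine isCompactOperator_of_tendsto (l := atTop)
    (F := fun n : ℕ => gridAverage Ω (n + 1) (S n) ∘L toL2) ?_
    (Eventually.of_forall fun n => (isCompactOperator_gridAverage _).comp_clm _)
  refine (tendsto_iff_norm_sub_tendsto_zero (E := H10 Ω →L[ℝ] L2 Ω)).2
    (squeeze_zero (fun _ => ContinuousLinearMap.opNorm_nonneg _)
    (fun n => norm_gridAverage_comp_toL2_sub_le (hS n)) ?_)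
  simpa using (tendsto_one_div_add_atTop_nhds_zero_nat.mul_const √d).const_mul _

end Rellich

/-! ### Dirichlet eigenvalues -/

section Listing

theorem exists_orderIso_nat {I : Type*} [LinearOrder I] [Infinite I]
    (hfin : ∀ i : I, (Set.Iio i).Finite) : Nonempty (ℕ ≃o I) := by
  have hmono : StrictMono fun i : I => (Set.Iio i).ncard := fun i j hij =>
    Set.ncard_lt_ncard (Set.Iio_ssubset_Iio hij) (hfin j)
  have : Infinite (Set.range fun i : I => (Set.Iio i).ncard) :=
    (Set.infinite_range_of_injective hmono.injective).to_subtype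
  exact ⟨(Nat.Subtype.orderIsoOfNat _).trans hmono.orderIso.symm⟩

theorem exists_equiv_nat_monotone {I α : Type*} [LinearOrder α] [Infinite I] {f : I → α}
    (hf : ∀ N, {i | f i ≤ N}.Finite) : ∃ e : ℕ ≃ I, Monotone (f ∘ e) := by
  -- Ties are broken by an arbitrary linear order of `I`.
  let g : I → α ×ₗ Cardinal := fun i => toLex (f i, embeddingToCardinal i)
  have hg : g.Injective := fun i j h =>
    embeddingToCardinal.injective (congrArg (fun p => (ofLex p).2) h)
  have hle {i j : I} (h : g i ≤ g j) : f i ≤ f j := Prod.Lex.monotone_fst _ _ h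
  have hfin (p : Set.range g) : (Set.Iio p).Finite := by
    obtain ⟨-, i, rfl⟩ := p
    refine ((hf (f i)).image (Set.rangeFactorization g)).subset ?_
    rintro ⟨-, j, rfl⟩ hj
    exact ⟨j, hle (le_of_lt hj), rfl⟩
  have : Infinite (Set.range g) := (Set.infinite_range_of_injective hg).to_subtype
  obtain ⟨e⟩ := exists_orderIso_nat hfin
  refine ⟨e.toEquiv.trans (Equiv.ofInjective g hg).symm, fun m n hmn => hle ?_⟩
  simpa [Equiv.apply_ofInjective_symm hg] using hmn

end Listing

section Eigenspaces

open H10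

variable {d : ℕ} {Ω : Opens (EuclideanSpace ℝ (Fin d))} {μ : ℝ} {u : H10 Ω}

theorem mem_dirichletEigenspace_iff : u ∈ dirichletEigenspace Ω μ ↔
    ∀ v, inner ℝ (grad u) (grad v) = μ * inner ℝ (toL2 u) (toL2 v) :=
  Iff.rfl

variable (Ω) in
/-- The operator `T = ι† ∘ ι` on `H¹₀(Ω)`, where `ι` is the inclusion into `L²(Ω)`. Its
eigenvalues are the numbers `(1 + μ)⁻¹` with `μ` a Dirichlet eigenvalue. -/
def massOperator : H10 Ω →L[ℝ] H10 Ω := (toL2 (Ω := Ω)).adjoint ∘L toL2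

theorem inner_massOperator (u v : H10 Ω) :
    inner ℝ (massOperator Ω u) v = inner ℝ (toL2 u) (toL2 v) := by
  rw [massOperator, ContinuousLinearMap.comp_apply, ContinuousLinearMap.adjoint_inner_left]

theorem isSymmetric_massOperator : (massOperator Ω).IsSymmetric := fun u v =>
  (inner_massOperator u v).trans
    (((real_inner_comm _ _).trans (inner_massOperator v u).symm).trans (real_inner_comm _ _))

theorem isCompactOperator_massOperator
    (hbdd : Bornology.IsBounded (Ω : Set (EuclideanSpace ℝ (Fin d)))) :
    IsCompactOperator (massOperator Ω) :=
  (isCompactOperator_toL2 hbdd).clm_comp (toL2 (Ω := Ω)).adjoint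

theorem mem_dirichletEigenspace_iff_massOperator (hμ : 1 + μ ≠ 0) :
    u ∈ dirichletEigenspace Ω μ ↔ massOperator Ω u = (1 + μ)⁻¹ • u := by
  rw [mem_dirichletEigenspace_iff, eq_inv_smul_iff₀ hμ, ext_iff_inner_right ℝ]
  refine forall_congr' fun v => ?_
  rw [inner_smul_left, inner_massOperator, inner_eq, add_comm (inner ℝ (toL2 u) _),
    one_add_mul, add_comm (inner ℝ (toL2 u) _), add_left_inj, eq_comm]

theorem dirichletEigenspace_eq_eigenspace (hμ : 1 + μ ≠ 0) : dirichletEigenspace Ω μ =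
    Module.End.eigenspace (massOperator Ω : Module.End ℝ (H10 Ω)) (1 + μ)⁻¹ := by
  ext u
  rw [mem_dirichletEigenspace_iff_massOperator hμ, Module.End.mem_eigenspace_iff,
    ContinuousLinearMap.coe_coe]

theorem nonneg_of_massOperator_eq_smul {τ : ℝ} (h : massOperator Ω u = τ • u) (hu : u ≠ 0) :
    0 ≤ τ := by
  have hτ := inner_massOperator u u
  rw [h, inner_smul_left, real_inner_self_eq_norm_sq, real_inner_self_eq_norm_sq] at hτ
  exact nonneg_of_mul_nonneg_left (hτ.ge.trans' (sq_nonneg _)) (by positivity)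

theorem norm_grad_sq_of_mem_dirichletEigenspace (hu : u ∈ dirichletEigenspace Ω μ) :
    ‖grad u‖ ^ 2 = μ * ‖toL2 u‖ ^ 2 := by
  simpa only [real_inner_self_eq_norm_sq] using mem_dirichletEigenspace_iff.1 hu u

theorem inner_eq_of_mem_dirichletEigenspace (hu : u ∈ dirichletEigenspace Ω μ) (v : H10 Ω) :
    inner ℝ u v = (1 + μ) * inner ℝ (toL2 u) (toL2 v) := by
  rw [inner_eq, mem_dirichletEigenspace_iff.1 hu, one_add_mul]

theorem inner_toL2_eq_zero_of_ne {ν : ℝ} (hne : μ ≠ ν) {v : H10 Ω}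
    (hu : u ∈ dirichletEigenspace Ω μ) (hv : v ∈ dirichletEigenspace Ω ν) :
    inner ℝ (toL2 u) (toL2 v) = 0 := by
  have h : μ * inner ℝ (toL2 u) (toL2 v) = ν * inner ℝ (toL2 u) (toL2 v) := by
    rw [← mem_dirichletEigenspace_iff.1 hu, real_inner_comm (toL2 v),
      ← mem_dirichletEigenspace_iff.1 hv, real_inner_comm]
  exact (mul_eq_mul_right_iff.1 h).resolve_left hne

theorem eq_zero_of_grad_eq_zero (hd : 1 ≤ d)
    (hbdd : Bornology.IsBounded (Ω : Set (EuclideanSpace ℝ (Fin d)))) (hu : grad u = 0) :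
    u = 0 := by
  have h := neg_two_mul_inner_partialDeriv_mulCoord hbdd ⟨0, hd⟩ u
  rw [partialDeriv, ContinuousLinearMap.comp_apply, hu, map_zero, inner_zero_left, mul_zero] at h
  rw [← norm_eq_zero, ← sq_eq_zero_iff, norm_sq_eq, ← h, hu, norm_zero, sq, mul_zero, add_zero]

theorem pos_of_mem_dirichletEigenspace (hd : 1 ≤ d)
    (hbdd : Bornology.IsBounded (Ω : Set (EuclideanSpace ℝ (Fin d))))
    (hu : u ∈ dirichletEigenspace Ω μ) (hu0 : u ≠ 0) : 0 < μ := by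
  have hgrad : 0 < ‖grad u‖ ^ 2 :=
    pow_pos (norm_pos_iff.2 fun h => hu0 (eq_zero_of_grad_eq_zero hd hbdd h)) 2
  rw [norm_grad_sq_of_mem_dirichletEigenspace hu] at hgrad
  exact pos_of_mul_pos_left hgrad (sq_nonneg _)

theorem pos_of_dirichletEigenspace_ne_bot (hd : 1 ≤ d)
    (hbdd : Bornology.IsBounded (Ω : Set (EuclideanSpace ℝ (Fin d))))
    (hμ : dirichletEigenspace Ω μ ≠ ⊥) : 0 < μ := by
  obtain ⟨u, hu, hu0⟩ := Submodule.exists_mem_ne_zero_of_ne_bot hμ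
  exact pos_of_mem_dirichletEigenspace hd hbdd hu hu0

theorem finiteDimensional_dirichletEigenspace (hd : 1 ≤ d)
    (hbdd : Bornology.IsBounded (Ω : Set (EuclideanSpace ℝ (Fin d)))) (μ : ℝ) :
    FiniteDimensional ℝ (dirichletEigenspace Ω μ) := by
  rcases eq_or_ne (dirichletEigenspace Ω μ) ⊥ with h | h
  · rw [h]
    infer_instance
  · have hμ : 1 + μ ≠ 0 := by linarith [pos_of_dirichletEigenspace_ne_bot hd hbdd h]
    rw [dirichletEigenspace_eq_eigenspace hμ]
    exact (massOperator Ω).finite_dimensional_eigenspace (isCompactOperator_massOperator hbdd) _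
      (inv_ne_zero hμ)

theorem finite_setOf_dirichletEigenspace_ne_bot (hd : 1 ≤ d)
    (hbdd : Bornology.IsBounded (Ω : Set (EuclideanSpace ℝ (Fin d)))) (N : ℝ) :
    {μ : ℝ | μ ≤ N ∧ dirichletEigenspace Ω μ ≠ ⊥}.Finite := by
  rcases lt_or_ge N 0 with hN | hN
  · refine Set.finite_empty.subset fun μ hμ => ?_
    exact absurd (pos_of_dirichletEigenspace_ne_bot hd hbdd hμ.2) (hμ.1.trans hN.le).not_gt
  refine ((finite_setOf_hasEigenvalue_of_isCompactOperator (isCompactOperator_massOperator hbdd)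
    isSymmetric_massOperator (t := (1 + N)⁻¹) (by positivity)).image fun τ => τ⁻¹ - 1).subset ?_
  rintro μ ⟨hμN, hμ⟩
  have hpos := pos_of_dirichletEigenspace_ne_bot hd hbdd hμ
  rw [dirichletEigenspace_eq_eigenspace (by positivity)] at hμ
  refine ⟨(1 + μ)⁻¹, ⟨?_, hμ⟩, by simp⟩
  rw [Real.norm_of_nonneg (by positivity)]
  gcongr

/-- Half of the min-max principle: a function orthogonal in `L²` to all eigenfunctions for
eigenvalues below `z` has Rayleigh quotient at least `z`. -/
theorem mul_norm_toL2_sq_le_norm_grad_sq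
    (hbdd : Bornology.IsBounded (Ω : Set (EuclideanSpace ℝ (Fin d)))) {z : ℝ} (hz : 0 ≤ z)
    {w : H10 Ω}
    (hw : ∀ μ < z, ∀ u ∈ dirichletEigenspace Ω μ, inner ℝ (toL2 u) (toL2 w) = 0) :
    z * ‖toL2 w‖ ^ 2 ≤ ‖grad w‖ ^ 2 := by
  have hz' : 0 < 1 + z := by positivity
  have horth : ∀ τ : ℝ, (1 + z)⁻¹ < ‖τ‖ → ∀ u, massOperator Ω u = τ • u → inner ℝ u w = 0 := by
    intro τ hτ u hu
    rcases eq_or_ne u 0 with rfl | hu0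
    · exact inner_zero_left _
    rw [Real.norm_of_nonneg (nonneg_of_massOperator_eq_smul hu hu0)] at hτ
    have hτ0 : 0 < τ := (inv_pos.2 hz').trans hτ
    have hmem : u ∈ dirichletEigenspace Ω (τ⁻¹ - 1) := by
      rw [mem_dirichletEigenspace_iff_massOperator (by simpa using hτ0.ne')]
      simpa using hu
    have hlt : τ⁻¹ - 1 < z := by linarith [(inv_lt_comm₀ hz' hτ0).1 hτ]
    rw [inner_eq_of_mem_dirichletEigenspace hmem, hw _ hlt u hmem, mul_zero]
  have hle : ‖toL2 w‖ ^ 2 ≤ (1 + z)⁻¹ * ‖w‖ ^ 2 := by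
    calc ‖toL2 w‖ ^ 2 = inner ℝ (massOperator Ω w) w := by
          rw [inner_massOperator, real_inner_self_eq_norm_sq]
      _ ≤ ‖massOperator Ω w‖ * ‖w‖ := real_inner_le_norm _ _
      _ ≤ (1 + z)⁻¹ * ‖w‖ * ‖w‖ := by
          gcongr
          exact norm_apply_le_of_orthogonal_eigenvectors (isCompactOperator_massOperator hbdd)
            isSymmetric_massOperator (by positivity) horth
      _ = (1 + z)⁻¹ * ‖w‖ ^ 2 := by ring
  rw [le_inv_mul_iff₀ hz', norm_sq_eq] at hle
  linarith

end Eigenspaces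

section Yang

open H10

variable {d : ℕ} {Ω : Opens (EuclideanSpace ℝ (Fin d))}
  (hbdd : Bornology.IsBounded (Ω : Set (EuclideanSpace ℝ (Fin d))))

include hbdd in
theorem norm_grad_sq_eq_of_mulCoord {μ : ℝ} {u w : H10 Ω} (hu : u ∈ dirichletEigenspace Ω μ)
    (a : Fin d) (h₀ : inner ℝ (toL2 (mulCoord hbdd a u - w)) (toL2 w) = 0)
    (h₁ : inner ℝ (grad (mulCoord hbdd a u - w)) (grad w) = 0) :
    ‖grad w‖ ^ 2 = μ * ‖toL2 w‖ ^ 2 - 2 * inner ℝ (partialDeriv a u) (toL2 w) := by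
  rw [map_sub, inner_sub_left, sub_eq_zero, real_inner_self_eq_norm_sq] at h₀ h₁
  rw [← h₁, ← h₀, inner_grad_mulCoord, mem_dirichletEigenspace_iff.1 hu, inner_toL2_mulCoord]

variable {ι : Type*} [Fintype ι] {b : ι → H10 Ω} {lam : ι → ℝ} {z : ℝ}

theorem gap_le_of_orthonormal_eigenfunctions (hz : 0 ≤ z)
    (hb : ∀ i, b i ∈ dirichletEigenspace Ω (lam i)) (hon : Orthonormal ℝ fun i => toL2 (b i))
    (hspan : ∀ μ < z, dirichletEigenspace Ω μ ≤ Submodule.span ℝ (Set.range b))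
    (a : Fin d) (i : ι) :
    (z - lam i) *
        ‖orthonormalResidual (fun j => toL2 (b j)) (toL2 (mulCoord hbdd a (b i)))‖ ^ 2 ≤
      -2 * inner ℝ (partialDeriv a (b i))
        (orthonormalResidual (fun j => toL2 (b j)) (toL2 (mulCoord hbdd a (b i)))) := by
  set p : H10 Ω := ∑ j, inner ℝ (toL2 (mulCoord hbdd a (b i))) (toL2 (b j)) • b j with hp
  set w : H10 Ω := mulCoord hbdd a (b i) - p with hw
  have hres : orthonormalResidual (fun j => toL2 (b j)) (toL2 (mulCoord hbdd a (b i))) =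
      toL2 w := by
    simp only [orthonormalResidual, w, p, map_sub, map_sum, map_smul]
  have horth (j : ι) : inner ℝ (toL2 (b j)) (toL2 w) = 0 := by
    rw [← hres]
    exact inner_apply_orthonormalResidual hon j _
  have hgap : z * ‖toL2 w‖ ^ 2 ≤ ‖grad w‖ ^ 2 := by
    refine mul_norm_toL2_sq_le_norm_grad_sq hbdd hz fun μ hμ u hu => ?_
    refine Submodule.span_induction (p := fun u _ => inner ℝ (toL2 u) (toL2 w) = 0)
      (by rintro _ ⟨j, rfl⟩; exact horth j) (by simp) (fun x y _ _ hx hy => ?_)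
      (fun c x _ hx => ?_) (hspan μ hμ hu)
    · rw [map_add, inner_add_left, hx, hy, add_zero]
    · rw [map_smul, real_inner_smul_left, hx, mul_zero]
  have h₀ : inner ℝ (toL2 (mulCoord hbdd a (b i) - w)) (toL2 w) = 0 := by
    rw [hw, sub_sub_cancel, ← hw, hp, map_sum, sum_inner]
    simp only [map_smul, real_inner_smul_left, horth, mul_zero, Finset.sum_const_zero]
  have h₁ : inner ℝ (grad (mulCoord hbdd a (b i) - w)) (grad w) = 0 := by
    rw [hw, sub_sub_cancel, ← hw, hp, map_sum, sum_inner]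
    simp only [map_smul, real_inner_smul_left, mem_dirichletEigenspace_iff.1 (hb _), horth,
      mul_zero, Finset.sum_const_zero]
  rw [hres]
  linarith [norm_grad_sq_eq_of_mulCoord hbdd (hb i) a h₀ h₁]

include hbdd in
theorem sum_sq_le_sum_mul_norm_partialDeriv_sq (hz : 0 ≤ z) (hlam : ∀ i, lam i ≤ z)
    (hb : ∀ i, b i ∈ dirichletEigenspace Ω (lam i)) (hon : Orthonormal ℝ fun i => toL2 (b i))
    (hspan : ∀ μ < z, dirichletEigenspace Ω μ ≤ Submodule.span ℝ (Set.range b)) (a : Fin d) :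
    ∑ i, (z - lam i) ^ 2 ≤ 4 * ∑ i, (z - lam i) * ‖partialDeriv a (b i)‖ ^ 2 := by
  refine sum_sq_le_of_commutator (X := fun i => toL2 (mulCoord hbdd a (b i))) hon hlam
    (fun i j => ?_) (fun i j => ?_) (fun i => ?_)
    (gap_le_of_orthonormal_eigenfunctions hbdd hz hb hon hspan a)
  · rw [inner_toL2_mulCoord, real_inner_comm]
  · have h := inner_grad_mulCoord hbdd a (b i) (b j)
    rw [real_inner_comm, mem_dirichletEigenspace_iff.1 (hb i), mem_dirichletEigenspace_iff.1 (hb j),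
      ← inner_toL2_mulCoord, real_inner_comm, ← inner_toL2_mulCoord] at h
    linarith
  · rw [neg_two_mul_inner_partialDeriv_mulCoord, hon.1 i, one_pow]

include hbdd in
theorem mul_sum_sq_le_of_orthonormal_eigenfunctions (hz : 0 ≤ z) (hlam : ∀ i, lam i ≤ z)
    (hb : ∀ i, b i ∈ dirichletEigenspace Ω (lam i)) (hon : Orthonormal ℝ fun i => toL2 (b i))
    (hspan : ∀ μ < z, dirichletEigenspace Ω μ ≤ Submodule.span ℝ (Set.range b)) :
    (d : ℝ) * ∑ i, (z - lam i) ^ 2 ≤ 4 * ∑ i, (z - lam i) * lam i := by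
  have hnorm (i : ι) : ∑ a, ‖partialDeriv a (b i)‖ ^ 2 = lam i := by
    rw [← norm_grad_sq, norm_grad_sq_of_mem_dirichletEigenspace (hb i), hon.1 i, one_pow, mul_one]
  calc (d : ℝ) * ∑ i, (z - lam i) ^ 2 = ∑ _a : Fin d, ∑ i, (z - lam i) ^ 2 := by
        rw [Finset.sum_const, Finset.card_univ, Fintype.card_fin, nsmul_eq_mul]
    _ ≤ ∑ a, 4 * ∑ i, (z - lam i) * ‖partialDeriv a (b i)‖ ^ 2 :=
        Finset.sum_le_sum fun a _ =>
          sum_sq_le_sum_mul_norm_partialDeriv_sq hbdd hz hlam hb hon hspan a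
    _ = 4 * ∑ i, (z - lam i) * lam i := by
        rw [← Finset.mul_sum, Finset.sum_comm]
        simp only [← Finset.mul_sum, hnorm]

end Yang

theorem exists_orthonormal_span {H : Type*} [NormedAddCommGroup H] [InnerProductSpace ℝ H]
    (E : Submodule ℝ H) [FiniteDimensional ℝ E] :
    ∃ v : Fin (Module.finrank ℝ E) → H, (∀ i, v i ∈ E) ∧ Orthonormal ℝ v ∧
      Submodule.span ℝ (Set.range v) = E := by
  let b := stdOrthonormalBasis ℝ E
  refine ⟨fun i => b i, fun i => (b i).2, b.orthonormal.comp_linearIsometry E.subtypeₗᵢ, ?_⟩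
  have h := congrArg (Submodule.map E.subtype) b.toBasis.span_eq
  rwa [Submodule.map_span, ← Set.range_comp, Submodule.map_top, Submodule.range_subtype,
    b.coe_toBasis] at h

section Spectrum

open H10

variable {d : ℕ} {Ω : Opens (EuclideanSpace ℝ (Fin d))}

theorem exists_orthonormal_toL2_span_eq {μ : ℝ} (hμ : 0 < 1 + μ)
    [FiniteDimensional ℝ (dirichletEigenspace Ω μ)] :
    ∃ v : Fin (Module.finrank ℝ (dirichletEigenspace Ω μ)) → H10 Ω,
      Orthonormal ℝ (fun j => toL2 (v j)) ∧
        Submodule.span ℝ (Set.range v) = dirichletEigenspace Ω μ := by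
  obtain ⟨e, he, heo, hspan⟩ := exists_orthonormal_span (dirichletEigenspace Ω μ)
  refine ⟨fun j => √(1 + μ) • e j, orthonormal_iff_ite.2 fun i j => ?_, ?_⟩
  · rw [map_smul, map_smul, real_inner_smul_left, real_inner_smul_right, ← mul_assoc,
      Real.mul_self_sqrt hμ.le, ← inner_eq_of_mem_dirichletEigenspace (he i)]
    exact orthonormal_iff_ite.1 heo i j
  · rw [← Set.smul_set_range, Submodule.span_smul_eq_of_isUnit _ _ (Real.sqrt_pos.2 hμ).ne'.isUnit,
      hspan]

variable (Ω) in
/-- An index set for the Dirichlet eigenvalues of `Ω`, counted with multiplicity. -/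
abbrev EigenIndex : Type := Σ μ : ℝ, Fin (Module.finrank ℝ (dirichletEigenspace Ω μ))

variable (hd : 1 ≤ d) (hbdd : Bornology.IsBounded (Ω : Set (EuclideanSpace ℝ (Fin d))))

theorem EigenIndex.dirichletEigenspace_ne_bot (i : EigenIndex Ω) :
    dirichletEigenspace Ω i.1 ≠ ⊥ := fun h =>
  i.2.pos.ne' (by rw [h, finrank_bot])

include hd hbdd

theorem EigenIndex.pos (i : EigenIndex Ω) : 0 < i.1 :=
  pos_of_dirichletEigenspace_ne_bot hd hbdd (EigenIndex.dirichletEigenspace_ne_bot i)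

theorem EigenIndex.finite_setOf_le (N : ℝ) : {i : EigenIndex Ω | i.1 ≤ N}.Finite := by
  refine ((finite_setOf_dirichletEigenspace_ne_bot hd hbdd N).biUnion
    (t := fun μ => Set.range fun j => (⟨μ, j⟩ : EigenIndex Ω))
    fun μ _ => Set.finite_range _).subset fun i hi => ?_
  exact Set.mem_biUnion ⟨hi, EigenIndex.dirichletEigenspace_ne_bot i⟩ ⟨i.2, rfl⟩

theorem exists_orthonormal_eigenfunctions : ∃ b : EigenIndex Ω → H10 Ω,
    Orthonormal ℝ (fun i => toL2 (b i)) ∧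
      ∀ μ, Submodule.span ℝ (Set.range fun j => b ⟨μ, j⟩) = dirichletEigenspace Ω μ := by
  have hfd := finiteDimensional_dirichletEigenspace (Ω := Ω) hd hbdd
  have hbasis (μ : ℝ) : ∃ v : Fin (Module.finrank ℝ (dirichletEigenspace Ω μ)) → H10 Ω,
      Orthonormal ℝ (fun j => toL2 (v j)) ∧
        Submodule.span ℝ (Set.range v) = dirichletEigenspace Ω μ := by
    rcases le_or_gt (1 + μ) 0 with hμ | hμ
    · have hbot : dirichletEigenspace Ω μ = ⊥ := by
        by_contra h
        linarith [pos_of_dirichletEigenspace_ne_bot hd hbdd h]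
      have : IsEmpty (Fin (Module.finrank ℝ (dirichletEigenspace Ω μ))) := by
        rw [hbot, finrank_bot]
        infer_instance
      exact ⟨isEmptyElim, ⟨isEmptyElim, fun i => isEmptyElim i⟩, by simp [hbot]⟩
    · exact exists_orthonormal_toL2_span_eq hμ
  choose v hvon hvspan using hbasis
  have hv (i : EigenIndex Ω) : v i.1 i.2 ∈ dirichletEigenspace Ω i.1 :=
    (hvspan i.1).le (Submodule.subset_span ⟨i.2, rfl⟩)
  refine ⟨fun i => v i.1 i.2, ⟨fun i => (hvon i.1).1 i.2, ?_⟩, hvspan⟩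
  rintro ⟨μ, i⟩ ⟨ν, j⟩ hij
  rcases eq_or_ne μ ν with rfl | hne
  · exact (hvon μ).2 fun h => hij (congrArg (Sigma.mk μ) h)
  · exact inner_toL2_eq_zero_of_ne hne (hv ⟨μ, i⟩) (hv ⟨ν, j⟩)

omit hd hbdd in
theorem exists_toL2_ne_zero (hne : (Ω : Set (EuclideanSpace ℝ (Fin d))).Nonempty) :
    ∃ u : H10 Ω, toL2 u ≠ 0 := by
  obtain ⟨x, hx⟩ := hne
  obtain ⟨f, hsupp, hcomp, hsmooth, -, hfx⟩ :=
    exists_contDiff_tsupport_subset (n := ⊤) (Ω.isOpen.mem_nhds hx)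
  let φ : 𝓓(Ω, ℝ) := ⟨f, hsmooth, hcomp, hsupp⟩
  refine ⟨ofTestFunction φ, fun h0 => ?_⟩
  have hae : φ =ᵐ[volume.restrict (Ω : Set (EuclideanSpace ℝ (Fin d)))] fun _ => (0 : ℝ) :=
    (coeFn_testPair_fst φ).symm.trans
      ((congrArg (⇑) h0).eventuallyEq.trans (Lp.coeFn_zero _ _ _))
  exact one_ne_zero (hfx.symm.trans (Measure.eqOn_open_of_ae_eq hae Ω.isOpen
    φ.continuous.continuousOn continuousOn_const hx))

theorem nonempty_eigenIndex (hne : (Ω : Set (EuclideanSpace ℝ (Fin d))).Nonempty) :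
    Nonempty (EigenIndex Ω) := by
  by_contra hempty
  rw [not_nonempty_iff] at hempty
  obtain ⟨b, -, hspan⟩ := exists_orthonormal_eigenfunctions (Ω := Ω) hd hbdd
  obtain ⟨w, hw⟩ := exists_toL2_ne_zero hne
  have hpos : 0 < ‖toL2 w‖ ^ 2 := pow_pos (norm_pos_iff.2 hw) 2
  have hray (z : ℝ) (hz : 0 ≤ z) : z * ‖toL2 w‖ ^ 2 ≤ ‖grad w‖ ^ 2 := by
    refine mul_norm_toL2_sq_le_norm_grad_sq hbdd hz fun μ _ u hu => ?_
    have hj : IsEmpty (Fin (Module.finrank ℝ (dirichletEigenspace Ω μ))) :=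
      ⟨fun j => hempty.false ⟨μ, j⟩⟩
    rw [← hspan μ, Set.range_eq_empty, Submodule.span_empty, Submodule.mem_bot] at hu
    rw [hu, map_zero, inner_zero_left]
  have h := hray ((‖grad w‖ ^ 2 + 1) / ‖toL2 w‖ ^ 2) (by positivity)
  rw [div_mul_cancel₀ _ hpos.ne'] at h
  linarith

theorem infinite_eigenIndex (hne : (Ω : Set (EuclideanSpace ℝ (Fin d))).Nonempty) :
    Infinite (EigenIndex Ω) := by
  refine not_finite_iff_infinite.1 fun hfin => ?_
  have := Fintype.ofFinite (EigenIndex Ω)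
  have := nonempty_eigenIndex hd hbdd hne
  obtain ⟨b, hon, hspan⟩ := exists_orthonormal_eigenfunctions (Ω := Ω) hd hbdd
  obtain ⟨M, hM⟩ := (Set.finite_range fun i : EigenIndex Ω => i.1).bddAbove
  have hle (i : EigenIndex Ω) : i.1 ≤ M := hM ⟨i, rfl⟩
  have hpos := EigenIndex.pos (Ω := Ω) hd hbdd
  have hM0 : 0 < M := (hpos (Classical.arbitrary _)).trans_le (hle _)
  have hyang := mul_sum_sq_le_of_orthonormal_eigenfunctions hbdd (b := b) (lam := fun i => i.1)
    (z := 6 * M) (by positivity) (fun i => by linarith [hle i])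
    (fun i => (hspan i.1).le (Submodule.subset_span ⟨i.2, rfl⟩)) hon
    fun μ _ => (hspan μ).ge.trans (Submodule.span_mono (by rintro _ ⟨j, rfl⟩; exact ⟨_, rfl⟩))
  have hlt : 4 * ∑ i : EigenIndex Ω, (6 * M - i.1) * i.1 <
      1 * ∑ i : EigenIndex Ω, (6 * M - i.1) ^ 2 := by
    rw [Finset.mul_sum, one_mul]
    refine Finset.sum_lt_sum_of_nonempty Finset.univ_nonempty fun i _ => ?_
    nlinarith [hle i, hpos i]
  refine (hyang.trans_lt hlt).not_ge (mul_le_mul_of_nonneg_right ?_ ?_)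
  · exact_mod_cast hd
  · exact Finset.sum_nonneg fun i _ => sq_nonneg _

theorem mk_fin_finrank_dirichletEigenspace (μ : ℝ) :
    Cardinal.mk (Fin (Module.finrank ℝ (dirichletEigenspace Ω μ))) =
      Module.rank ℝ (dirichletEigenspace Ω μ) := by
  have := finiteDimensional_dirichletEigenspace (Ω := Ω) hd hbdd μ
  rw [Cardinal.mk_fin, Module.finrank_eq_rank]

theorem exists_isDirichletSpectrum (hne : (Ω : Set (EuclideanSpace ℝ (Fin d))).Nonempty) :
    ∃ lam : ℕ → ℝ, IsDirichletSpectrum Ω lam := by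
  have := infinite_eigenIndex hd hbdd hne
  obtain ⟨e, he⟩ := exists_equiv_nat_monotone (EigenIndex.finite_setOf_le (Ω := Ω) hd hbdd)
  refine ⟨fun k => (e k).1, he, fun μ => ?_⟩
  rw [← mk_fin_finrank_dirichletEigenspace hd hbdd, Cardinal.eq]
  exact ⟨(e.subtypeEquiv fun k => Iff.rfl).trans (Equiv.sigmaSubtype μ)⟩

omit hd hbdd

namespace IsDirichletSpectrum

variable {lam : ℕ → ℝ} (hlam : IsDirichletSpectrum Ω lam)

include hlam hd hbdd

theorem exists_equiv : ∃ e : ℕ ≃ EigenIndex Ω, ∀ k, (e k).1 = lam k := by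
  have h (μ : ℝ) : Nonempty ({k // lam k = μ} ≃
      Fin (Module.finrank ℝ (dirichletEigenspace Ω μ))) := by
    rw [← Cardinal.eq, mk_fin_finrank_dirichletEigenspace hd hbdd, hlam.multiplicity]
  exact ⟨(Equiv.sigmaFiberEquiv lam).symm.trans (Equiv.sigmaCongrRight fun μ => (h μ).some),
    fun k => rfl⟩

theorem pos (k : ℕ) : 0 < lam k := by
  obtain ⟨e, he⟩ := hlam.exists_equiv hd hbdd
  exact he k ▸ EigenIndex.pos hd hbdd (e k)

theorem tendsto_atTop : Tendsto lam atTop atTop := by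
  obtain ⟨e, he⟩ := hlam.exists_equiv hd hbdd
  refine hlam.monotone.tendsto_atTop_atTop fun N => ?_
  by_contra! h
  refine Set.infinite_univ (α := ℕ) (((EigenIndex.finite_setOf_le hd hbdd N).preimage
    e.injective.injOn).subset fun k _ => ?_)
  exact (he k).trans_le (h k).le

theorem yang_inequality {z : ℝ} (hz : 0 ≤ z) {s : Finset ℕ} (hs : ∀ k, k ∈ s ↔ lam k < z) :
    (d : ℝ) * ∑ k ∈ s, (z - lam k) ^ 2 ≤ 4 * ∑ k ∈ s, (z - lam k) * lam k := by
  obtain ⟨e, he⟩ := hlam.exists_equiv hd hbdd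
  obtain ⟨b, hon, hspan⟩ := exists_orthonormal_eigenfunctions (Ω := Ω) hd hbdd
  have h := mul_sum_sq_le_of_orthonormal_eigenfunctions hbdd (ι := s) (b := fun k => b (e k))
    (lam := fun k => lam k) hz (fun k => ((hs k).1 k.2).le)
    (fun k => by
      rw [← he, ← hspan]
      exact Submodule.subset_span ⟨(e k).2, rfl⟩)
    (hon.comp _ (e.injective.comp Subtype.val_injective)) fun μ hμ => by
      rw [← hspan]
      refine Submodule.span_mono ?_
      rintro _ ⟨j, rfl⟩
      have hk : (e (e.symm ⟨μ, j⟩)) = ⟨μ, j⟩ := e.apply_symm_apply _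
      exact ⟨⟨e.symm ⟨μ, j⟩, (hs _).2 (by rwa [← he, hk])⟩, congrArg b hk⟩
  rwa [Finset.sum_coe_sort s fun k => (z - lam k) ^ 2,
    Finset.sum_coe_sort s fun k => (z - lam k) * lam k] at h

end IsDirichletSpectrum

end Spectrum

/-! ### Riesz means -/

section RieszTerm

/-- The summand `(z - l)₊^σ` of the Riesz mean, which vanishes at `z = l` for every `σ`. -/
def rieszTerm (σ l z : ℝ) : ℝ := if l < z then (z - l) ^ σ else 0

variable {σ l z : ℝ}

theorem rieszTerm_of_lt (h : l < z) : rieszTerm σ l z = (z - l) ^ σ := if_pos h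

theorem rieszTerm_of_le (h : z ≤ l) : rieszTerm σ l z = 0 := if_neg h.not_gt

theorem rieszTerm_eq_mul (σ l z : ℝ) : rieszTerm σ l z = rieszTerm (σ - 1) l z * (z - l) := by
  rcases lt_or_ge l z with h | h
  · rw [rieszTerm_of_lt h, rieszTerm_of_lt h, ← Real.rpow_add_one (sub_pos.2 h).ne',
      sub_add_cancel]
  · rw [rieszTerm_of_le h, rieszTerm_of_le h, zero_mul]

theorem rieszTerm_eq_max_rpow (hσ : 0 < σ) (l z : ℝ) : rieszTerm σ l z = max (z - l) 0 ^ σ := by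
  rcases lt_or_ge l z with h | h
  · rw [rieszTerm_of_lt h, max_eq_left (sub_pos.2 h).le]
  · rw [rieszTerm_of_le h, max_eq_right (sub_nonpos.2 h), Real.zero_rpow hσ.ne']

theorem continuous_rieszTerm (hσ : 0 < σ) (l : ℝ) : Continuous (rieszTerm σ l) := by
  rw [funext (rieszTerm_eq_max_rpow hσ l)]
  exact Continuous.rpow_const (by fun_prop) fun _ => Or.inr hσ.le

theorem monotone_rieszTerm (hσ : 0 < σ) (l : ℝ) : Monotone (rieszTerm σ l) := by
  intro z w hzw
  rw [rieszTerm_eq_max_rpow hσ, rieszTerm_eq_max_rpow hσ]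
  gcongr

theorem hasDerivAt_rieszTerm_of_ne (h : l ≠ z) :
    HasDerivAt (rieszTerm σ l) (σ * rieszTerm (σ - 1) l z) z := by
  rcases h.lt_or_gt with h | h
  · have hpow := ((hasDerivAt_id z).sub_const l).rpow_const (p := σ) (Or.inl (sub_pos.2 h).ne')
    rw [one_mul] at hpow
    rw [rieszTerm_of_lt h]
    refine hpow.congr_of_eventuallyEq ?_
    filter_upwards [lt_mem_nhds h] with w hw using rieszTerm_of_lt hw
  · rw [rieszTerm_of_le h.le, mul_zero]
    refine (hasDerivAt_const z (0 : ℝ)).congr_of_eventuallyEq ?_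
    filter_upwards [gt_mem_nhds h] with w hw using rieszTerm_of_le hw.le

theorem hasDerivAt_rieszTerm_self (hσ : 1 < σ) (l : ℝ) : HasDerivAt (rieszTerm σ l) 0 l := by
  rw [hasDerivAt_iff_tendsto_slope]
  have hlim : Tendsto (rieszTerm (σ - 1) l) (𝓝[≠] l) (𝓝 0) := by
    rw [← rieszTerm_of_le (σ := σ - 1) (le_refl l)]
    exact (continuous_rieszTerm (sub_pos.2 hσ) l).continuousWithinAt
  refine hlim.congr' ?_
  filter_upwards [self_mem_nhdsWithin] with w hw
  rw [slope_def_field, rieszTerm_of_le (le_refl l), sub_zero, rieszTerm_eq_mul σ,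
    mul_div_cancel_right₀ _ (sub_ne_zero.2 hw)]

theorem hasDerivAt_rieszTerm (h : 1 < σ ∨ l ≠ z) :
    HasDerivAt (rieszTerm σ l) (σ * rieszTerm (σ - 1) l z) z := by
  rcases eq_or_ne l z with rfl | hne
  · rw [rieszTerm_of_le le_rfl, mul_zero]
    exact hasDerivAt_rieszTerm_self (h.resolve_right fun hne => hne rfl) l
  · exact hasDerivAt_rieszTerm_of_ne hne

theorem exists_tendsto_le_slope_rieszTerm (hσ : 0 < σ) (l z : ℝ) :
    ∃ g : ℝ → ℝ, Tendsto g (𝓝[≠] z) (𝓝 (σ * rieszTerm (σ - 1) l z)) ∧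
      ∀ w, g w ≤ slope (rieszTerm σ l) z w := by
  rcases eq_or_ne l z with rfl | hne
  · refine ⟨fun _ => 0, ?_, fun w =>
      ((monotone_rieszTerm hσ l).monotoneOn Set.univ).slope_nonneg trivial trivial⟩
    rw [rieszTerm_of_le le_rfl, mul_zero]
    exact tendsto_const_nhds
  · exact ⟨_, (hasDerivAt_rieszTerm_of_ne hne).tendsto_slope, fun _ => le_rfl⟩

end RieszTerm

section RieszExponent

variable {p q σ l z c : ℝ}

theorem beta_add_one_right (hp : 0 < p) (hq : 0 < q) :
    ProbabilityTheory.beta p (q + 1) = q / (p + q) * ProbabilityTheory.beta p q := by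
  have hpq := add_pos hp hq
  rw [ProbabilityTheory.beta, ProbabilityTheory.beta, ← add_assoc, Real.Gamma_add_one hq.ne',
    Real.Gamma_add_one hpq.ne']
  have := (Real.Gamma_pos_of_pos hpq).ne'
  field_simp

theorem integral_sub_rpow_mul_rpow (hp : 0 < p) (hq : 0 < q) (hz : 0 < z) :
    ∫ t in 0..z, (z - t) ^ (p - 1) * t ^ (q - 1) =
      ProbabilityTheory.beta p q * z ^ (p + q - 1) := by
  have hcast : ∫ t in 0..z, (t : ℂ) ^ ((q : ℂ) - 1) * ((z : ℂ) - t) ^ ((p : ℂ) - 1) =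
      ((∫ t in 0..z, (z - t) ^ (p - 1) * t ^ (q - 1) : ℝ) : ℂ) := by
    rw [← intervalIntegral.integral_ofReal]
    refine intervalIntegral.integral_congr fun t ht => ?_
    rw [Set.uIcc_of_le hz.le] at ht
    push_cast [Complex.ofReal_cpow ht.1, Complex.ofReal_cpow (sub_nonneg.2 ht.2)]
    exact mul_comm _ _
  have h := (Complex.betaIntegral_scaled q p hz).symm.trans hcast
  rw [Complex.betaIntegral_symm, ← Complex.ofReal_add, ← Complex.ofReal_one, ← Complex.ofReal_sub,
    ← Complex.ofReal_cpow hz.le] at h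
  rw [← Complex.ofReal_re (∫ t in 0..z, _), ← h, Complex.re_ofReal_mul,
    ← ProbabilityTheory.beta_eq_betaIntegralReal p q hp hq, mul_comm, add_comm q]

theorem intervalIntegrable_sub_rpow (hp : 0 < p) (z a b : ℝ) :
    IntervalIntegrable (fun t => (z - t) ^ (p - 1)) volume a b := by
  have h := (intervalIntegral.intervalIntegrable_rpow' (r := p - 1) (by linarith)
    (a := z - a) (b := z - b)).comp_sub_left z
  simpa only [sub_sub_cancel] using h

theorem intervalIntegrable_sub_rpow_mul_rieszTerm (hp : 0 < p) (hq : 0 < q) (l z a b : ℝ) :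
    IntervalIntegrable (fun t => (z - t) ^ (p - 1) * rieszTerm q l t) volume a b :=
  (intervalIntegrable_sub_rpow hp z a b).mul_continuousOn (continuous_rieszTerm hq l).continuousOn

theorem integral_mul_rieszTerm_of_le (f : ℝ → ℝ) (hzl : z ≤ l) {a : ℝ} (haz : a ≤ z) :
    ∫ t in a..z, f t * rieszTerm σ l t = 0 := by
  refine intervalIntegral.integral_zero_ae (Eventually.of_forall fun t ht => ?_)
  rw [Set.uIoc_of_le haz] at ht
  rw [rieszTerm_of_le (ht.2.trans hzl), mul_zero]

theorem integral_sub_rpow_mul_rieszTerm (hp : 0 < p) (hq : 0 < q) (hl : 0 ≤ l) (hz : 0 ≤ z) :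
    ∫ t in 0..z, (z - t) ^ (p - 1) * rieszTerm q l t =
      ProbabilityTheory.beta p (q + 1) * rieszTerm (p + q) l z := by
  rcases le_or_gt z l with hzl | hlz
  · rw [integral_mul_rieszTerm_of_le _ hzl hz, rieszTerm_of_le hzl, mul_zero]
  have hshift : ∫ t in l..z, (z - t) ^ (p - 1) * rieszTerm q l t =
      ∫ t in 0..z - l, (z - l - t) ^ (p - 1) * t ^ (q + 1 - 1) := by
    rw [← sub_self l, ← intervalIntegral.integral_comp_sub_right _ l]
    refine intervalIntegral.integral_congr fun t ht => ?_
    rw [Set.uIcc_of_le hlz.le] at ht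
    simp only [rieszTerm_eq_max_rpow hq, max_eq_left (sub_nonneg.2 ht.1), sub_sub_sub_cancel_right,
      add_sub_cancel_right]
  rw [← intervalIntegral.integral_add_adjacent_intervals
    (intervalIntegrable_sub_rpow_mul_rieszTerm hp hq l z 0 l)
    (intervalIntegrable_sub_rpow_mul_rieszTerm hp hq l z l z),
    integral_mul_rieszTerm_of_le _ le_rfl hl, zero_add, hshift,
    integral_sub_rpow_mul_rpow hp (by linarith) (sub_pos.2 hlz), rieszTerm_of_lt hlz]
  congr 2
  ring

theorem intervalIntegrable_sub_rpow_mul_rieszTerm_sub (hp : 0 < p) (hq : 1 < q) (c l z : ℝ) :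
    IntervalIntegrable
      (fun t => (z - t) ^ (p - 1) * (rieszTerm (q - 1) l t * l - c * rieszTerm q l t))
      volume 0 z :=
  (intervalIntegrable_sub_rpow hp z 0 z).mul_continuousOn
    (((continuous_rieszTerm (sub_pos.2 hq) l).mul_const l).sub
      ((continuous_rieszTerm (one_pos.trans hq) l).const_mul c)).continuousOn

theorem integral_sub_rpow_mul_rieszTerm_sub (hp : 0 < p) (hq : 1 < q) (c : ℝ) (hl : 0 ≤ l)
    (hz : 0 ≤ z) :
    ∫ t in 0..z, (z - t) ^ (p - 1) * (rieszTerm (q - 1) l t * l - c * rieszTerm q l t) =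
      ProbabilityTheory.beta p q *
        (rieszTerm (p + q - 1) l z * l - q / (p + q) * c * rieszTerm (p + q) l z) := by
  have hq0 := one_pos.trans hq
  have hq1 := sub_pos.2 hq
  simp_rw [mul_sub, ← mul_assoc, mul_right_comm _ c]
  rw [intervalIntegral.integral_sub
    ((intervalIntegrable_sub_rpow_mul_rieszTerm hp hq1 l z 0 z).mul_const l)
    ((intervalIntegrable_sub_rpow_mul_rieszTerm hp hq0 l z 0 z).mul_const c),
    intervalIntegral.integral_mul_const, intervalIntegral.integral_mul_const,
    integral_sub_rpow_mul_rieszTerm hp hq1 hl hz, integral_sub_rpow_mul_rieszTerm hp hq0 hl hz,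
    beta_add_one_right hp hq0, sub_add_cancel, ← add_sub_assoc]
  ring

variable {ι : Type*} {s : Finset ι} {lam : ι → ℝ}

/-- Riesz iteration: integrate the inequality at `t` against `(z - t) ^ (σ - q - 1)`. -/
theorem mul_sum_rieszTerm_le_of_le (hlam : ∀ k ∈ s, 0 ≤ lam k) (hq : 1 < q) (hσ : q ≤ σ)
    (hz : 0 ≤ z)
    (h : ∀ t ∈ Set.Icc 0 z, c * ∑ k ∈ s, rieszTerm q (lam k) t ≤
      ∑ k ∈ s, rieszTerm (q - 1) (lam k) t * lam k) :
    q / σ * c * ∑ k ∈ s, rieszTerm σ (lam k) z ≤ ∑ k ∈ s, rieszTerm (σ - 1) (lam k) z * lam k := by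
  rcases hσ.eq_or_lt with rfl | hσ
  · rw [div_self (by linarith), one_mul]
    exact h z ⟨hz, le_rfl⟩
  obtain ⟨p, hp, rfl⟩ : ∃ p, 0 < p ∧ σ = p + q := ⟨σ - q, sub_pos.2 hσ, by ring⟩
  have hint : 0 ≤ ∫ t in 0..z, ∑ k ∈ s, (z - t) ^ (p - 1) *
      (rieszTerm (q - 1) (lam k) t * lam k - c * rieszTerm q (lam k) t) := by
    refine intervalIntegral.integral_nonneg hz fun t ht => ?_
    rw [← Finset.mul_sum, Finset.sum_sub_distrib, ← Finset.mul_sum]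
    exact mul_nonneg (Real.rpow_nonneg (sub_nonneg.2 ht.2) _) (sub_nonneg.2 (h t ht))
  rw [intervalIntegral.integral_finsetSum fun k _ =>
      intervalIntegrable_sub_rpow_mul_rieszTerm_sub hp hq c (lam k) z,
    Finset.sum_congr rfl fun k hk => integral_sub_rpow_mul_rieszTerm_sub hp hq c (hlam k hk) hz,
    ← Finset.mul_sum, Finset.sum_sub_distrib, ← Finset.mul_sum] at hint
  exact sub_nonneg.1 (nonneg_of_mul_nonneg_right hint
    (ProbabilityTheory.beta_pos hp (one_pos.trans hq)))

/-- Both sides are a nonnegative multiple of `w - (z - l)`, where `w = z / (1 + c)`; as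
`(z - l) ^ (σ - q)` decreases in `z - l`, replacing it by its value at `z - l = w` can only decrease
the product. -/
theorem rpow_mul_rieszTerm_sub_le (hc : 0 < c) (hσ : σ ≤ q) (hz : 0 < z) (l : ℝ) :
    (z / (1 + c)) ^ (σ - q) * (rieszTerm (q - 1) l z * l - c * rieszTerm q l z) ≤
      rieszTerm (σ - 1) l z * l - c * rieszTerm σ l z := by
  rcases le_or_gt z l with hzl | hlz
  · simp only [rieszTerm_of_le hzl, zero_mul, mul_zero, sub_self, le_refl]
  set w := z / (1 + c) with hw
  have hw0 : 0 < w := by positivity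
  have hx0 : 0 < z - l := sub_pos.2 hlz
  have hfactor (τ : ℝ) : rieszTerm (τ - 1) l z * l - c * rieszTerm τ l z =
      (z - l) ^ (τ - 1) * ((1 + c) * (w - (z - l))) := by
    rw [rieszTerm_eq_mul τ, rieszTerm_of_lt hlz, hw]
    field_simp
    ring
  have hpow : (z - l) ^ (σ - 1) = (z - l) ^ (σ - q) * (z - l) ^ (q - 1) := by
    rw [← Real.rpow_add hx0, sub_add_sub_cancel]
  rw [hfactor, hfactor, hpow, mul_assoc, ← sub_nonneg, ← sub_mul, mul_left_comm]
  refine mul_nonneg (Real.rpow_nonneg hx0.le _) ?_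
  rcases le_total (z - l) w with hle | hle
  · exact mul_nonneg (sub_nonneg.2 (Real.rpow_le_rpow_of_nonpos hx0 hle (by linarith)))
      (mul_nonneg (by positivity) (sub_nonneg.2 hle))
  · exact mul_nonneg_of_nonpos_of_nonpos
      (sub_nonpos.2 (Real.rpow_le_rpow_of_nonpos hw0 hle (by linarith)))
      (mul_nonpos_of_nonneg_of_nonpos (by positivity) (sub_nonpos.2 hle))

theorem mul_sum_rieszTerm_le_of_ge (hc : 0 < c) (hσ : σ ≤ q) (hz : 0 < z)
    (h : c * ∑ k ∈ s, rieszTerm q (lam k) z ≤ ∑ k ∈ s, rieszTerm (q - 1) (lam k) z * lam k) :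
    c * ∑ k ∈ s, rieszTerm σ (lam k) z ≤ ∑ k ∈ s, rieszTerm (σ - 1) (lam k) z * lam k := by
  have hsum := Finset.sum_le_sum fun k (_ : k ∈ s) => rpow_mul_rieszTerm_sub_le hc hσ hz (lam k)
  simp only [← Finset.mul_sum, Finset.sum_sub_distrib] at hsum
  exact sub_nonneg.1 ((mul_nonneg (by positivity) (sub_nonneg.2 h)).trans hsum)

end RieszExponent

section RieszMean

theorem le_of_deriv_nonneg_off_finset {f : ℝ → ℝ} (S : Finset ℝ) {a b : ℝ} (hab : a ≤ b)
    (hf : ContinuousOn f (Set.Icc a b))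
    (hf' : ∀ x ∈ Set.Ioo a b, x ∉ S → DifferentiableAt ℝ f x ∧ 0 ≤ deriv f x) : f a ≤ f b := by
  induction S using Finset.induction_on generalizing a b with
  | empty =>
    rw [← interior_Icc] at hf'
    exact monotoneOn_of_deriv_nonneg (convex_Icc a b) hf
      (fun x hx => (hf' x hx (Finset.notMem_empty x)).1.differentiableWithinAt)
      (fun x hx => (hf' x hx (Finset.notMem_empty x)).2) (Set.left_mem_Icc.2 hab)
      (Set.right_mem_Icc.2 hab) hab
  | insert s S _ ih =>
    by_cases hs : s ∈ Set.Ioo a b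
    · refine (ih hs.1.le (hf.mono (Set.Icc_subset_Icc_right hs.2.le)) fun x hx hxS => ?_).trans
        (ih hs.2.le (hf.mono (Set.Icc_subset_Icc_left hs.1.le)) fun x hx hxS => ?_)
      · exact hf' x ⟨hx.1, hx.2.trans hs.2⟩ (by simp [hx.2.ne, hxS])
      · exact hf' x ⟨hs.1.trans hx.1, hx.2⟩ (by simp [hx.1.ne', hxS])
    · refine ih hab hf fun x hx hxS => hf' x hx ?_
      rw [Finset.mem_insert, not_or]
      exact ⟨fun hxs => hs (hxs ▸ hx), hxS⟩

theorem hasDerivAt_div_rpow {f : ℝ → ℝ} {f' x : ℝ} (hf : HasDerivAt f f' x) (hx : 0 < x) (α : ℝ) :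
    HasDerivAt (fun z => f z / z ^ α) ((f' - α / x * f x) / x ^ α) x := by
  have hxα := (Real.rpow_pos_of_pos hx α).ne'
  refine (hf.div (Real.hasDerivAt_rpow_const (Or.inl hx.ne')) hxα).congr_deriv ?_
  rw [Real.rpow_sub_one hx.ne']
  field_simp

variable {lam : ℕ → ℝ}

theorem exists_finset_forall_lt_mem (htend : Tendsto lam atTop atTop) (Z : ℝ) :
    ∃ s : Finset ℕ, ∀ k, lam k < Z → k ∈ s := by
  obtain ⟨N, hN⟩ := eventually_atTop.1 (htend.eventually_ge_atTop Z)
  exact ⟨Finset.range N, fun k hk => Finset.mem_range.2 (not_le.1 fun h => hk.not_ge (hN k h))⟩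

theorem rieszMean_eq_sum {s : Finset ℕ} {Z z : ℝ} (hs : ∀ k, lam k < Z → k ∈ s) (hz : z ≤ Z)
    (σ : ℝ) : rieszMean lam σ z = ∑ k ∈ s, rieszTerm σ (lam k) z :=
  tsum_eq_sum fun k hk => rieszTerm_of_le (hz.trans (not_lt.1 (mt (hs k) hk)))

theorem exists_rieszMean_eventuallyEq_sum (htend : Tendsto lam atTop atTop) (z : ℝ) :
    ∃ s : Finset ℕ, ∀ σ, rieszMean lam σ =ᶠ[𝓝 z] fun w => ∑ k ∈ s, rieszTerm σ (lam k) w := by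
  obtain ⟨s, hs⟩ := exists_finset_forall_lt_mem htend (z + 1)
  refine ⟨s, fun σ => ?_⟩
  filter_upwards [gt_mem_nhds (lt_add_one z)] with w hw using rieszMean_eq_sum hs hw.le σ

theorem continuous_rieszMean (htend : Tendsto lam atTop atTop) {σ : ℝ} (hσ : 0 < σ) :
    Continuous (rieszMean lam σ) := by
  refine continuous_iff_continuousAt.2 fun z => ?_
  obtain ⟨s, hs⟩ := exists_rieszMean_eventuallyEq_sum htend z
  exact (continuous_finsetSum s fun k _ => continuous_rieszTerm hσ (lam k)).continuousAt.congr
    (hs σ).symm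

theorem hasDerivAt_rieszMean (htend : Tendsto lam atTop atTop) {σ z : ℝ}
    (h : 1 < σ ∨ ∀ k, lam k ≠ z) :
    HasDerivAt (rieszMean lam σ) (σ * rieszMean lam (σ - 1) z) z := by
  obtain ⟨s, hs⟩ := exists_rieszMean_eventuallyEq_sum htend z
  rw [(hs _).eq_of_nhds, Finset.mul_sum]
  exact (HasDerivAt.fun_sum fun k _ =>
    hasDerivAt_rieszTerm (h.imp_right fun h => h k)).congr_of_eventuallyEq (hs σ)

theorem eventually_lt_slope_rieszMean (htend : Tendsto lam atTop atTop) {σ z c : ℝ} (hσ : 0 < σ)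
    (hc : c < σ * rieszMean lam (σ - 1) z) :
    ∀ᶠ w in 𝓝[≠] z, c < slope (rieszMean lam σ) z w := by
  obtain ⟨s, hs⟩ := exists_rieszMean_eventuallyEq_sum htend z
  choose g hg hle using fun k => exists_tendsto_le_slope_rieszTerm hσ (lam k) z
  rw [(hs _).eq_of_nhds, Finset.mul_sum] at hc
  filter_upwards [(tendsto_finsetSum s fun k _ => hg k).eventually_const_lt hc,
    nhdsWithin_le_nhds (hs σ)] with w hw hsw
  calc c < ∑ k ∈ s, g k w := hw
    _ ≤ ∑ k ∈ s, slope (rieszTerm σ (lam k)) z w := Finset.sum_le_sum fun k _ => hle k w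
    _ = slope (rieszMean lam σ) z w := by
      simp only [slope_def_field, hsw, (hs σ).eq_of_nhds, ← Finset.sum_div, Finset.sum_sub_distrib]

theorem monotoneOn_rieszMean_div_rpow (htend : Tendsto lam atTop atTop) {σ α z₀ : ℝ} (hσ : 0 < σ)
    (hz₀ : 0 < z₀) (h : ∀ z, z₀ ≤ z → α / z * rieszMean lam σ z ≤ σ * rieszMean lam (σ - 1) z) :
    MonotoneOn (fun z => rieszMean lam σ z / z ^ α) (Set.Ici z₀) := by
  intro a ha b _ hab
  have hpos : ∀ x ∈ Set.Icc a b, 0 < x := fun x hx => hz₀.trans_le (ha.trans hx.1)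
  obtain ⟨s, hs⟩ := exists_finset_forall_lt_mem htend b
  refine le_of_deriv_nonneg_off_finset (f := fun z => rieszMean lam σ z / z ^ α)
    (s.image lam) hab ?_ fun x hx hxs => ?_
  · exact (continuous_rieszMean htend hσ).continuousOn.div
      (continuousOn_id.rpow_const fun x hx => Or.inl (hpos x hx).ne')
      fun x hx => (Real.rpow_pos_of_pos (hpos x hx) α).ne'
  · have hx0 := hpos x (Set.Ioo_subset_Icc_self hx)
    have hne (k : ℕ) : lam k ≠ x := fun hk =>
      hxs (Finset.mem_image.2 ⟨k, hs k (hk.trans_lt hx.2), hk⟩)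
    have hderiv := hasDerivAt_div_rpow (hasDerivAt_rieszMean htend (σ := σ) (Or.inr hne)) hx0 α
    refine ⟨hderiv.differentiableAt, hderiv.deriv ▸ ?_⟩
    exact div_nonneg (sub_nonneg.2 (h x (ha.trans hx.1.le))) (Real.rpow_nonneg hx0.le α)

theorem le_rieszMean_sub_one {σ c z : ℝ} (hz : 0 < z) {s : Finset ℕ} (hs : ∀ k, lam k < z → k ∈ s)
    (h : c * ∑ k ∈ s, rieszTerm σ (lam k) z ≤ ∑ k ∈ s, rieszTerm (σ - 1) (lam k) z * lam k) :
    (1 + c) * (1 / z) * rieszMean lam σ z ≤ rieszMean lam (σ - 1) z := by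
  have hsplit : z * ∑ k ∈ s, rieszTerm (σ - 1) (lam k) z =
      ∑ k ∈ s, rieszTerm σ (lam k) z + ∑ k ∈ s, rieszTerm (σ - 1) (lam k) z * lam k := by
    rw [Finset.mul_sum, ← Finset.sum_add_distrib]
    refine Finset.sum_congr rfl fun k _ => ?_
    rw [rieszTerm_eq_mul σ]
    ring
  rw [rieszMean_eq_sum hs le_rfl, rieszMean_eq_sum hs le_rfl, mul_one_div, div_mul_eq_mul_div,
    div_le_iff₀ hz, mul_comm _ z, hsplit]
  linarith

end RieszMean

namespace IsDirichletSpectrum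

variable {d : ℕ} {Ω : Opens (EuclideanSpace ℝ (Fin d))} {lam : ℕ → ℝ} {σ z : ℝ}
  (hlam : IsDirichletSpectrum Ω lam) (hd : 1 ≤ d)
  (hbdd : Bornology.IsBounded (Ω : Set (EuclideanSpace ℝ (Fin d))))

include hlam hd hbdd

theorem mul_sum_rieszTerm_two_le (hz : 0 ≤ z) {s : Finset ℕ} (hs : ∀ k, lam k < z → k ∈ s) :
    (d : ℝ) / 4 * ∑ k ∈ s, rieszTerm 2 (lam k) z ≤
      ∑ k ∈ s, rieszTerm (2 - 1) (lam k) z * lam k := by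
  have h := hlam.yang_inequality hd hbdd hz (s := s.filter fun k => lam k < z) fun k => by
    rw [Finset.mem_filter, and_iff_right_iff_imp]
    exact hs k
  rw [Finset.sum_filter, Finset.sum_filter] at h
  norm_num only
  simp only [rieszTerm, Real.rpow_two, Real.rpow_one, ite_mul, zero_mul]
  linarith

theorem le_rieszMean_sub_one_of_le_two (hσ : σ ≤ 2) (hz : 0 < z) :
    (1 + (d : ℝ) / 4) * (1 / z) * rieszMean lam σ z ≤ rieszMean lam (σ - 1) z := by
  obtain ⟨s, hs⟩ := exists_finset_forall_lt_mem (hlam.tendsto_atTop hd hbdd) z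
  exact le_rieszMean_sub_one hz hs (mul_sum_rieszTerm_le_of_ge (by positivity) hσ hz
    (hlam.mul_sum_rieszTerm_two_le hd hbdd hz.le hs))

theorem le_mul_rieszMean_sub_one_of_le_two (hσ : 0 < σ) (hσ2 : σ ≤ 2) (hz : 0 < z) :
    (1 + (d : ℝ) / 4) * (σ / z) * rieszMean lam σ z ≤ σ * rieszMean lam (σ - 1) z := by
  refine (Eq.le ?_).trans
    (mul_le_mul_of_nonneg_left (hlam.le_rieszMean_sub_one_of_le_two hd hbdd hσ2 hz) hσ.le)
  ring

theorem le_rieszMean_sub_one_of_two_le (hσ : 2 ≤ σ) (hz : 0 < z) :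
    (1 + (d : ℝ) / (2 * σ)) * (1 / z) * rieszMean lam σ z ≤ rieszMean lam (σ - 1) z := by
  obtain ⟨s, hs⟩ := exists_finset_forall_lt_mem (hlam.tendsto_atTop hd hbdd) z
  have hc : 2 / σ * ((d : ℝ) / 4) = d / (2 * σ) := by
    field_simp
    norm_num
  refine le_rieszMean_sub_one hz hs (hc ▸ mul_sum_rieszTerm_le_of_le
    (fun k _ => (hlam.pos hd hbdd k).le) one_lt_two hσ hz.le fun t ht => ?_)
  exact hlam.mul_sum_rieszTerm_two_le hd hbdd ht.1 fun k hk => hs k (hk.trans_le ht.2)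

theorem le_mul_rieszMean_sub_one_of_two_le (hσ : 2 ≤ σ) (hz : 0 < z) :
    (σ + (d : ℝ) / 2) * (1 / z) * rieszMean lam σ z ≤ σ * rieszMean lam (σ - 1) z := by
  have hσ0 : 0 < σ := two_pos.trans_le hσ
  refine (Eq.le ?_).trans
    (mul_le_mul_of_nonneg_left (hlam.le_rieszMean_sub_one_of_two_le hd hbdd hσ hz) hσ0.le)
  field_simp

end IsDirichletSpectrum

end

theorem theorem2p1 {d : ℕ} (hd : 1 ≤ d) (Ω : Opens (EuclideanSpace ℝ (Fin d)))
    (hne : (Ω : Set (EuclideanSpace ℝ (Fin d))).Nonempty)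
    (hbdd : Bornology.IsBounded (Ω : Set (EuclideanSpace ℝ (Fin d)))) :
    (∃ lam : ℕ → ℝ, IsDirichletSpectrum Ω lam) ∧
    ∀ lam : ℕ → ℝ, IsDirichletSpectrum Ω lam →
      0 < lam 0 ∧ Tendsto lam atTop atTop ∧
      (∀ σ : ℝ, 0 < σ → σ ≤ 2 →
        (∀ z : ℝ, lam 0 ≤ z →
          rieszMean lam (σ - 1) z ≥ (1 + (d : ℝ) / 4) * (1 / z) * rieszMean lam σ z) ∧
        (∀ z : ℝ, lam 0 ≤ z → (1 < σ ∨ ∀ k, lam k ≠ z) →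
          DifferentiableAt ℝ (rieszMean lam σ) z ∧
          deriv (rieszMean lam σ) z ≥ (1 + (d : ℝ) / 4) * (σ / z) * rieszMean lam σ z) ∧
        (∀ z : ℝ, lam 0 ≤ z →
          ∀ c : ℝ, c < (1 + (d : ℝ) / 4) * (σ / z) * rieszMean lam σ z →
            ∀ᶠ w in 𝓝[≠] z, c < slope (rieszMean lam σ) z w) ∧
        MonotoneOn (fun z : ℝ => rieszMean lam σ z / z ^ (σ + (d : ℝ) * σ / 4))
          (Set.Ici (lam 0))) ∧
      (∀ σ : ℝ, 2 ≤ σ →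
        (∀ z : ℝ, lam 0 ≤ z →
          rieszMean lam (σ - 1) z ≥ (1 + (d : ℝ) / (2 * σ)) * (1 / z) * rieszMean lam σ z) ∧
        (∀ z : ℝ, lam 0 ≤ z →
          DifferentiableAt ℝ (rieszMean lam σ) z ∧
          deriv (rieszMean lam σ) z ≥ (σ + (d : ℝ) / 2) * (1 / z) * rieszMean lam σ z) ∧
        MonotoneOn (fun z : ℝ => rieszMean lam σ z / z ^ (σ + (d : ℝ) / 2))
          (Set.Ici (lam 0))) := by
  refine ⟨exists_isDirichletSpectrum hd hbdd hne, fun lam hlam => ?_⟩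
  have hpos : 0 < lam 0 := hlam.pos hd hbdd 0
  have htend := hlam.tendsto_atTop hd hbdd
  refine ⟨hpos, htend, fun σ hσ hσ2 => ?_, fun σ hσ2 => ?_⟩
  · have hR (z : ℝ) (hz : lam 0 ≤ z) :=
      hlam.le_mul_rieszMean_sub_one_of_le_two hd hbdd hσ hσ2 (hpos.trans_le hz)
    refine ⟨fun z hz => hlam.le_rieszMean_sub_one_of_le_two hd hbdd hσ2 (hpos.trans_le hz),
      fun z hz h => ?_, fun z hz c hc => ?_, ?_⟩
    · have hderiv := hasDerivAt_rieszMean htend h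
      exact ⟨hderiv.differentiableAt, hderiv.deriv ▸ hR z hz⟩
    · exact eventually_lt_slope_rieszMean htend hσ (hc.trans_le (hR z hz))
    · refine monotoneOn_rieszMean_div_rpow htend hσ hpos fun z hz => (Eq.le ?_).trans (hR z hz)
      ring
  · have hR (z : ℝ) (hz : lam 0 ≤ z) :=
      hlam.le_mul_rieszMean_sub_one_of_two_le hd hbdd hσ2 (hpos.trans_le hz)
    refine ⟨fun z hz => hlam.le_rieszMean_sub_one_of_two_le hd hbdd hσ2 (hpos.trans_le hz),
      fun z hz => ?_, ?_⟩
    · have hderiv := hasDerivAt_rieszMean htend (z := z) (Or.inl (one_lt_two.trans_le hσ2))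
      exact ⟨hderiv.differentiableAt, hderiv.deriv ▸ hR z hz⟩
    · exact monotoneOn_rieszMean_div_rpow htend (two_pos.trans_le hσ2) hpos fun z hz => by
        simpa only [mul_one_div] using hR z hz
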